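/- Let $\mathcal Y$ be a connected smooth manifold and let $\mathscr H_1,\mathscr H_2\to\mathcal Y$ be smooth complex Hilbert space bundles with unitary trivializations and model spaces $H_1,H_2$. Let $\mathscr D\to\mathcal Y$ be a further smooth Hilbert space bundle, with model space $\mathcal D$, continuously embedded in $\mathscr H_1$ with fiberwise dense image, such that the trivializations of $\mathscr H_1$ restrict to smooth trivializations of $\mathscr D$ (with respect to a fixed continuous dense embedding $\mathcal D\subset H_1$). Let $\Sigma\subset\mathbb C$ be open and connected, and let $$\mathscr P_y(\sigma):\mathscr D_y\subset\mathscr H_{1,y}\to\mathscr H_{2,y},\qquad (y,\sigma)\in\mathcal Y\times\Sigma,$$ be a family of closed Fredholm operators of index $0$ which, in trivializations, is smooth in $(y,\sigma)$ as a family of bounded operators $\mathcal D\to H_2$, which is holomorphic in $\sigma$, and which for each $y$ is invertible for some $\sigma\in\Sigma$. Put $$\mathrm{sing}_b(\mathscr P_y)=\{\sigma\in\Sigma:\mathscr P_y(\sigma)\text{ is not invertible}\},\qquad \mathrm{sing}_e(\mathscr P)=\{(y,\sigma)\in \mathcal Y\times\Sigma:\sigma\in\mathrm{sing}_b(\mathscr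 P_y)\}.$$ Assume that $\mathrm{sing}_b(\mathscr P_y)$ is finite for each $y$, that $\mathrm{sing}_e(\mathscr P)$ is closed in $\mathcal Y\times\mathbb C$, and that every $y_0\in\mathcal Y$ has a neighborhood $U$ for which $\bigcup_{y\in U}\mathrm{sing}_b(\mathscr P_y)$ is bounded. For $y\in\mathcal Y$ let $\mathscr K_y$ be the complex vector space of all functions $\mathfrak s_\Sigma(\phi)$, where $\phi$ is a $\mathscr D_y$-valued meromorphic function on $\Sigma$ such that $\mathscr P_y\phi$ is holomorphic on $\Sigma$, and $\mathfrak s_\Sigma(\phi)$ is the sum of the singular parts of $\phi$ at its poles, i.e. the finite sum of terms $(\sigma-p)^{-k}a$ with $p\in\Sigma$, $k\ge1$, $a\in\mathscr D_y$ for which $\phi-\mathfrak s_\Sigma(\phi)$ is holomorphic on $\Sigma$. Let $\mathscr K=\bigsqcup_{y\in\mathcal Y}\mathscr K_y$ with the canonical map $\pi:\mathscr K\to\mathcal Y$. Let $\mathscr B^\infty(\mathcal Y;\mathscr K)$ be the space of those right inverses of $\pi$ which, viewed by way of the trivializations as $\mathcal D$-valued functions of $(y,\sigma)$, are smooth on $(\mathcal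 Y\times\mathbb C)\setminus\mathrm{sing}_e(\mathscr P)$ and holomorphic in $\sigma$ there. Then $\pi:\mathscr K\to\mathcal Y$ has the structure of a smooth complex vector bundle of finite rank with fibers the vector spaces $\mathscr K_y$, and with respect to this structure its space of $C^\infty$ sections is exactly $\mathscr B^\infty(\mathcal Y;\mathscr K)$. -/

import Mathlib

open Bundle Filter Topology Set
open scoped Manifold ContDiff

namespace KernelBundle

noncomputable section

/-! ### Vector-valued meromorphic functions and their singular parts -/

section Meromorphic

variable {E F : Type*} [NormedAddCommGroup E] [NormedSpace ℂ E]
  [NormedAddCommGroup F] [NormedSpace ℂ F]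

/-- `f` is holomorphic near `p` after removal of a possible removable singularity at `p`. This is
what holomorphy at `p` means for meromorphic functions, whose values at single points carry no
information. -/
def IsRegularAt (f : ℂ → E) (p : ℂ) : Prop :=
  ∃ g : ℂ → E, AnalyticAt ℂ g p ∧ f =ᶠ[𝓝[≠] p] g

theorem IsRegularAt.zero (p : ℂ) : IsRegularAt (0 : ℂ → E) p :=
  ⟨0, analyticAt_const, EventuallyEq.rfl⟩

theorem IsRegularAt.add {f g : ℂ → E} {p : ℂ} (hf : IsRegularAt f p) (hg : IsRegularAt g p) :
    IsRegularAt (f + g) p := by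
  obtain ⟨f', hf', hf⟩ := hf
  obtain ⟨g', hg', hg⟩ := hg
  exact ⟨f' + g', hf'.add hg', hf.add hg⟩

theorem IsRegularAt.smul {f : ℂ → E} {p : ℂ} (c : ℂ) (hf : IsRegularAt f p) :
    IsRegularAt (c • f) p := by
  obtain ⟨f', hf', hf⟩ := hf
  exact ⟨c • f', hf'.const_smul, hf.const_smul c⟩

/-- The finite sums `∑ (σ - p)⁻ᵏ a` with `p ∈ V`, `k ≥ 1`, `a : E`, i.e. the rational functions on
`ℂ` that vanish at infinity and have their poles in `V`. (The value of such a sum at one of its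
poles is fixed by the convention `0⁻¹ = 0`, so two such sums are equal as soon as they agree off
their poles.) -/
def polarSums (V : Set ℂ) (E : Type*) [NormedAddCommGroup E] [NormedSpace ℂ E] :
    Submodule ℂ (ℂ → E) :=
  Submodule.span ℂ {s | ∃ p ∈ V, ∃ k : ℕ, ∃ a : E, s = fun σ => ((σ - p) ^ (k + 1))⁻¹ • a}

/-- `s` is the sum of the singular parts of `f` at all its poles in `V`: it is a finite sum of
terms `(σ - p)⁻ᵏ a`, `p ∈ V`, `k ≥ 1`, and `f - s` is holomorphic on `V`. -/
def IsSingularPart (V : Set ℂ) (f s : ℂ → E) : Prop :=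
  s ∈ polarSums V E ∧ ∀ p ∈ V, IsRegularAt (f - s) p

/-- The points of `S` at which the family `A` is not invertible. -/
def singPts (S : Set ℂ) (A : ℂ → E →L[ℂ] F) : Set ℂ :=
  {σ | σ ∈ S ∧ ¬ (A σ).IsInvertible}

/-- The space of the singular parts of those `E`-valued meromorphic functions `φ` on `S` for which
`A φ` is holomorphic on `S`. -/
def kernelSpace (S : Set ℂ) (A : ℂ → E →L[ℂ] F) : Submodule ℂ (ℂ → E) where
  carrier := {s | ∃ φ : ℂ → E, MeromorphicOn φ S ∧
    (∀ p ∈ S, IsRegularAt (fun σ => A σ (φ σ)) p) ∧ IsSingularPart S φ s}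
  add_mem' := by
    rintro s t ⟨φ, hφ, hAφ, hs, hs'⟩ ⟨ψ, hψ, hAψ, ht, ht'⟩
    refine ⟨φ + ψ, hφ.add hψ, fun p hp => ?_, add_mem hs ht, fun p hp => ?_⟩
    · have h := (hAφ p hp).add (hAψ p hp)
      have e : (fun σ => A σ ((φ + ψ) σ)) = (fun σ => A σ (φ σ)) + fun σ => A σ (ψ σ) := by
        ext σ; simp
      rwa [e]
    · have h := (hs' p hp).add (ht' p hp)
      have e : φ + ψ - (s + t) = (φ - s) + (ψ - t) := by abel
      rwa [e]
  zero_mem' := by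
    refine ⟨0, fun p _ => MeromorphicAt.const 0 p, fun p _ => ?_, zero_mem _, fun p _ => ?_⟩
    · have e : (fun σ => A σ ((0 : ℂ → E) σ)) = 0 := by ext σ; simp
      rw [e]; exact IsRegularAt.zero p
    · rw [sub_zero]; exact IsRegularAt.zero p
  smul_mem' := by
    rintro c s ⟨φ, hφ, hAφ, hs, hs'⟩
    refine ⟨c • φ, fun p hp => (MeromorphicAt.const c p).smul (hφ p hp), fun p hp => ?_,
      Submodule.smul_mem _ c hs, fun p hp => ?_⟩
    · have h := (hAφ p hp).smul c
      have e : (fun σ => A σ ((c • φ) σ)) = c • fun σ => A σ (φ σ) := by ext σ; simp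
      rwa [e]
    · have h := (hs' p hp).smul c
      rwa [smul_sub] at h

end Meromorphic

/-! ### Smooth complex vector bundles and Hilbert space bundles over a real manifold -/

section Bundles

variable {Y : Type*} [TopologicalSpace Y]

/-- A complex vector bundle is a real vector bundle. With this instance,
`ContMDiffVectorBundle ∞ F E I` says that a complex vector bundle over a real manifold has smooth
transition functions. -/
instance vectorBundleReal (F : Type*) [NormedAddCommGroup F] [NormedSpace ℂ F]
    (E : Y → Type*) [∀ y, AddCommGroup (E y)] [∀ y, Module ℂ (E y)]
    [∀ y, TopologicalSpace (E y)] [TopologicalSpace (TotalSpace F E)] [FiberBundle F E]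
    [VectorBundle ℂ F E] : VectorBundle ℝ F E := by
  have lin : ∀ (e : Trivialization F (π F E)) [MemTrivializationAtlas e], e.IsLinear ℝ := by
    intro e _
    refine ⟨fun y hy => ?_⟩
    have h := Trivialization.linear (R := ℂ) e hy
    refine ⟨h.map_add, fun c x => ?_⟩
    have := h.map_smul (c : ℂ) x
    simpa using this
  refine ⟨fun e _ => lin e, fun e e' _ _ => ?_⟩
  have h := continuousOn_coordChange ℂ e e'
  have h2 : Continuous (fun T : F →L[ℂ] F => T.restrictScalars ℝ) :=
    ContinuousLinearMap.continuous_restrictScalars (𝕜 := ℂ) (𝕜' := ℝ)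
  refine (h2.comp_continuousOn h).congr fun y hy => ?_
  ext v
  simp [Trivialization.coordChangeL_apply _ _ hy]

variable {n : ℕ} [ChartedSpace (EuclideanSpace ℝ (Fin n)) Y]

/-- The trivializations of the bundle are fiberwise unitary. -/
def HasUnitaryTrivializations (F : Type*) [NormedAddCommGroup F] [InnerProductSpace ℂ F]
    (E : Y → Type*) [∀ y, NormedAddCommGroup (E y)] [∀ y, InnerProductSpace ℂ (E y)]
    [TopologicalSpace (TotalSpace F E)] [FiberBundle F E] [VectorBundle ℂ F E] : Prop :=
  ∀ (e : Trivialization F (π F E)) [MemTrivializationAtlas e], ∀ y ∈ e.baseSet, ∀ v : E y,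
    ‖(e ⟨y, v⟩).2‖ = ‖v‖

/-- `e` is a smooth trivialization: it is fiberwise linear and changes smoothly to and from the
members of the trivialization atlas. -/
def IsSmoothTrivialization (n : ℕ) [ChartedSpace (EuclideanSpace ℝ (Fin n)) Y]
    {F : Type*} [NormedAddCommGroup F] [NormedSpace ℂ F]
    {E : Y → Type*} [∀ y, NormedAddCommGroup (E y)] [∀ y, NormedSpace ℂ (E y)]
    [TopologicalSpace (TotalSpace F E)] [FiberBundle F E] [VectorBundle ℂ F E]
    (e : Trivialization F (π F E)) : Prop :=
  ∃ _ : e.IsLinear ℂ, ∀ (e' : Trivialization F (π F E)) [MemTrivializationAtlas e'],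
    ContMDiffOn (𝓡 n) 𝓘(ℝ, F →L[ℂ] F) ∞ (fun y => (e.coordChangeL ℂ e' y : F →L[ℂ] F))
      (e.baseSet ∩ e'.baseSet) ∧
    ContMDiffOn (𝓡 n) 𝓘(ℝ, F →L[ℂ] F) ∞ (fun y => (e'.coordChangeL ℂ e y : F →L[ℂ] F))
      (e'.baseSet ∩ e.baseSet)

/-- The maps `i y : D y → H y` embed the bundle `D` in `H` continuously, with fiberwise dense image,
in such a way that every trivialization of `H` restricts to a smooth trivialization of `D`, in
which the embedding is a fixed continuous dense embedding `j` of the model space of `D` in that of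
`H`. -/
structure IsDenseSubbundle (n : ℕ) [ChartedSpace (EuclideanSpace ℝ (Fin n)) Y]
    {FD F : Type*} [NormedAddCommGroup FD] [NormedSpace ℂ FD]
    [NormedAddCommGroup F] [NormedSpace ℂ F]
    {D H : Y → Type*} [∀ y, NormedAddCommGroup (D y)] [∀ y, NormedSpace ℂ (D y)]
    [TopologicalSpace (TotalSpace FD D)] [FiberBundle FD D] [VectorBundle ℂ FD D]
    [∀ y, NormedAddCommGroup (H y)] [∀ y, NormedSpace ℂ (H y)]
    [TopologicalSpace (TotalSpace F H)] [FiberBundle F H] [VectorBundle ℂ F H]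
    (j : FD →L[ℂ] F) (i : ∀ y, D y →L[ℂ] H y) : Prop where
  injective_model : Function.Injective j
  denseRange_model : DenseRange j
  injective : ∀ y, Function.Injective (i y)
  denseRange : ∀ y, DenseRange (i y)
  restrict : ∀ (e : Trivialization F (π F H)) [MemTrivializationAtlas e],
    ∃ e' : Trivialization FD (π FD D), IsSmoothTrivialization n e' ∧ e'.baseSet = e.baseSet ∧
      ∀ y ∈ e.baseSet, ∀ u : D y, (e ⟨y, i y u⟩).2 = j (e' ⟨y, u⟩).2

/-- `P y σ : D y ⊂ H₁ y → H₂ y`, `σ ∈ S`, is a smooth family of closed Fredholm operators of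
index `0` that is holomorphic in `σ` and, for each `y`, invertible for some `σ`. The inclusions of
the domains are `i y : D y → H₁ y`. -/
structure IsHolomorphicFredholmFamily (n : ℕ) [ChartedSpace (EuclideanSpace ℝ (Fin n)) Y]
    (FD F₂ : Type*) [NormedAddCommGroup FD] [NormedSpace ℂ FD]
    [NormedAddCommGroup F₂] [NormedSpace ℂ F₂]
    {D H₁ H₂ : Y → Type*} [∀ y, NormedAddCommGroup (D y)] [∀ y, NormedSpace ℂ (D y)]
    [TopologicalSpace (TotalSpace FD D)] [FiberBundle FD D] [VectorBundle ℂ FD D]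
    [∀ y, NormedAddCommGroup (H₁ y)] [∀ y, NormedSpace ℂ (H₁ y)]
    [∀ y, NormedAddCommGroup (H₂ y)] [∀ y, NormedSpace ℂ (H₂ y)]
    [TopologicalSpace (TotalSpace F₂ H₂)] [FiberBundle F₂ H₂] [VectorBundle ℂ F₂ H₂]
    (i : ∀ y, D y →L[ℂ] H₁ y) (S : Set ℂ) (P : ∀ y, ℂ → D y →L[ℂ] H₂ y) : Prop where
  smooth : ∀ (e : Trivialization FD (π FD D)) [MemTrivializationAtlas e]
    (e₂ : Trivialization F₂ (π F₂ H₂)) [MemTrivializationAtlas e₂],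
    ContMDiffOn ((𝓡 n).prod 𝓘(ℝ, ℂ)) 𝓘(ℝ, FD →L[ℂ] F₂) ∞
      (fun p : Y × ℂ =>
        (e₂.continuousLinearMapAt ℂ p.1) ∘L (P p.1 p.2) ∘L (e.symmL ℂ p.1))
      ((e.baseSet ∩ e₂.baseSet) ×ˢ S)
  holomorphic : ∀ y, DifferentiableOn ℂ (P y) S
  closed : ∀ y, ∀ σ ∈ S, IsClosed {p : H₁ y × H₂ y | ∃ u : D y, p = (i y u, P y σ u)}
  fredholm : ∀ y, ∀ σ ∈ S, (P y σ).IsFredholm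
  index_eq_zero : ∀ y, ∀ σ ∈ S, (P y σ : D y →ₗ[ℂ] H₂ y).index = 0
  exists_invertible : ∀ y, ∃ σ ∈ S, (P y σ).IsInvertible

/-- The pairs `(y, σ)` with `σ ∈ S` for which `P y σ` is not invertible, as a subset of `Y × ℂ`. -/
def singGraph {D H₂ : Y → Type*} [∀ y, NormedAddCommGroup (D y)] [∀ y, NormedSpace ℂ (D y)]
    [∀ y, NormedAddCommGroup (H₂ y)] [∀ y, NormedSpace ℂ (H₂ y)]
    (S : Set ℂ) (P : ∀ y, ℂ → D y →L[ℂ] H₂ y) : Set (Y × ℂ) :=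
  {p | p.2 ∈ singPts S (P p.1)}

/-- The fiber over `y` of the kernel bundle, as a bare complex vector space: a topology is part
of a vector bundle structure. -/
def KernelFiber {D H₂ : Y → Type*} [∀ y, NormedAddCommGroup (D y)] [∀ y, NormedSpace ℂ (D y)]
    [∀ y, NormedAddCommGroup (H₂ y)] [∀ y, NormedSpace ℂ (H₂ y)]
    (S : Set ℂ) (P : ∀ y, ℂ → D y →L[ℂ] H₂ y) (y : Y) : Type _ :=
  ↥(kernelSpace S (P y))

section KernelFiber

variable {D H₂ : Y → Type*} [∀ y, NormedAddCommGroup (D y)] [∀ y, NormedSpace ℂ (D y)]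
  [∀ y, NormedAddCommGroup (H₂ y)] [∀ y, NormedSpace ℂ (H₂ y)]

instance (S : Set ℂ) (P : ∀ y, ℂ → D y →L[ℂ] H₂ y) (y : Y) : AddCommGroup (KernelFiber S P y) :=
  inferInstanceAs (AddCommGroup ↥(kernelSpace S (P y)))

instance (S : Set ℂ) (P : ∀ y, ℂ → D y →L[ℂ] H₂ y) (y : Y) : Module ℂ (KernelFiber S P y) :=
  inferInstanceAs (Module ℂ ↥(kernelSpace S (P y)))

/-- An element of the fiber over `y`, viewed as a `D y`-valued function on `ℂ`. -/
def KernelFiber.toFun {S : Set ℂ} {P : ∀ y, ℂ → D y →L[ℂ] H₂ y} {y : Y}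
    (s : KernelFiber S P y) : ℂ → D y :=
  Subtype.val (p := fun f : ℂ → D y => f ∈ kernelSpace S (P y)) s

end KernelFiber

/-- The sections of the family of vector spaces `KernelFiber S P y` which, viewed in
trivializations of `D` as functions of `(y, σ)`, are smooth in the complement of the singular set in
`Y × ℂ` and holomorphic in `σ` there. -/
def IsSmoothOffSing (n : ℕ) [ChartedSpace (EuclideanSpace ℝ (Fin n)) Y]
    (FD : Type*) [NormedAddCommGroup FD] [NormedSpace ℂ FD]
    {D H₂ : Y → Type*} [∀ y, NormedAddCommGroup (D y)] [∀ y, NormedSpace ℂ (D y)]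
    [TopologicalSpace (TotalSpace FD D)] [FiberBundle FD D]
    [∀ y, NormedAddCommGroup (H₂ y)] [∀ y, NormedSpace ℂ (H₂ y)]
    (S : Set ℂ) (P : ∀ y, ℂ → D y →L[ℂ] H₂ y) (s : ∀ y, KernelFiber S P y) : Prop :=
  (∀ (e : Trivialization FD (π FD D)) [MemTrivializationAtlas e],
    ContMDiffOn ((𝓡 n).prod 𝓘(ℝ, ℂ)) 𝓘(ℝ, FD) ∞
      (fun p : Y × ℂ => (e ⟨p.1, (s p.1).toFun p.2⟩).2)
      ((e.baseSet ×ˢ univ) \ singGraph S P)) ∧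
  ∀ y, DifferentiableOn ℂ (s y).toFun (singPts S (P y))ᶜ

end Bundles

end

end KernelBundle

open KernelBundle

/-!
Near `y₀`, consider `A y = P y` in trivializations, and enclose the singular points of `A y₀` in the
interior of a finite union `K` of closed discs in `S`. For `y` near `y₀` the singular points of
`A y` remain there, and `A y (u + s) = h` is an isomorphism between the pairs `(u, s)` of a
holomorphic function `u` on `K` and an element `s` of the kernel space of `A y`, and the holomorphic
functions `h` on `K`. Choose `h₁, …, hᵣ` so that the components `sⱼ` of their preimages form a basis
at `y₀`. With `h₁, …, hᵣ` fixed and `y` varying, the `sⱼ` remain a basis near `y₀`, because this is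
equivalent to the invertibility of the operator `(u, c) ↦ A y u + ∑ j, cⱼ hⱼ` between fixed Banach
spaces, which depends continuously on `y`.

This frame is smooth off the singular set: Cauchy's formula expresses `sⱼ` by the contour integrals
of `(A y)⁻¹ hⱼ` over small circles around the singular points of `A y₀`. Conversely, finitely many
evaluations of a section off the singular set recover its coefficients smoothly. The frames thus
have smooth transition functions, and the smooth sections of the bundle they define are those that
are smooth off the singular set.
-/

namespace KernelBundle

noncomputable section

theorem eventually_notMem_of_finite {X : Type*} [TopologicalSpace X] [T1Space X] {Z : Set X}
    (hZ : Z.Finite) (p : X) : ∀ᶠ z in 𝓝[≠] p, z ∉ Z := by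
  rw [eventually_nhdsWithin_iff]
  filter_upwards [(hZ.subset sdiff_subset).isClosed.isOpen_compl.mem_nhds
    (show p ∈ (Z \ {p})ᶜ by simp)] with z hz hzp hzZ
  exact hz ⟨hzZ, hzp⟩

/-! ### Regular points -/

section Regular

variable {E F : Type*} [NormedAddCommGroup E] [NormedSpace ℂ E]
  [NormedAddCommGroup F] [NormedSpace ℂ F]

/-- The functions that are holomorphic near `p` up to a removable singularity at `p`. -/
def regularAt (E : Type*) [NormedAddCommGroup E] [NormedSpace ℂ E] (p : ℂ) :
    Submodule ℂ (ℂ → E) where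
  carrier := {f | IsRegularAt f p}
  add_mem' := IsRegularAt.add
  zero_mem' := IsRegularAt.zero p
  smul_mem' := fun c _ h => h.smul c

theorem IsRegularAt.of_analyticAt {f : ℂ → E} {p : ℂ} (hf : AnalyticAt ℂ f p) : IsRegularAt f p :=
  ⟨f, hf, EventuallyEq.rfl⟩

theorem IsRegularAt.congr {f g : ℂ → E} {p : ℂ} (hf : IsRegularAt f p) (h : f =ᶠ[𝓝[≠] p] g) :
    IsRegularAt g p := by
  obtain ⟨f', hf', hf⟩ := hf
  exact ⟨f', hf', h.symm.trans hf⟩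

theorem IsRegularAt.sub {f g : ℂ → E} {p : ℂ} (hf : IsRegularAt f p) (hg : IsRegularAt g p) :
    IsRegularAt (f - g) p :=
  (regularAt E p).sub_mem hf hg

theorem analyticAt_clm_apply {A : ℂ → E →L[ℂ] F} {f : ℂ → E} {p : ℂ}
    (hA : AnalyticAt ℂ A p) (hf : AnalyticAt ℂ f p) : AnalyticAt ℂ (fun z => A z (f z)) p :=
  AnalyticAt.comp (g := fun x : (E →L[ℂ] F) × E => x.1 x.2) (f := fun z => (A z, f z))
    ((ContinuousLinearMap.id ℂ (E →L[ℂ] F)).analyticAt_bilinear (A p, f p)) (hA.prod hf)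

theorem IsRegularAt.clm_apply {A : ℂ → E →L[ℂ] F} {f : ℂ → E} {p : ℂ} (hA : AnalyticAt ℂ A p)
    (hf : IsRegularAt f p) : IsRegularAt (fun z => A z (f z)) p := by
  obtain ⟨g, hg, hfg⟩ := hf
  exact ⟨fun z => A z (g z), analyticAt_clm_apply hA hg, hfg.mono fun z hz => congrArg (A z) hz⟩

theorem IsRegularAt.const_clm_apply (T : E →L[ℂ] F) {f : ℂ → E} {p : ℂ} (hf : IsRegularAt f p) :
    IsRegularAt (fun z => T (f z)) p :=
  hf.clm_apply (A := fun _ => T) analyticAt_const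

theorem IsRegularAt.pow_smul {f : ℂ → E} {p : ℂ} (hf : IsRegularAt f p) (m : ℕ) :
    IsRegularAt (fun z => (z - p) ^ m • f z) p := by
  obtain ⟨g, hg, hfg⟩ := hf
  exact ⟨fun z => (z - p) ^ m • g z, ((analyticAt_id.sub analyticAt_const).pow m).smul hg,
    hfg.mono fun z hz => congrArg ((z - p) ^ m • ·) hz⟩

theorem IsRegularAt.exists_differentiable_update {f : ℂ → E} {p : ℂ} (hf : IsRegularAt f p)
    (hd : ∀ z ≠ p, DifferentiableAt ℂ f z) : ∃ v, Differentiable ℂ (Function.update f p v) := by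
  obtain ⟨g, hg, hfg⟩ := hf
  refine ⟨g p, fun z => ?_⟩
  rcases eq_or_ne z p with rfl | hz
  · refine hg.differentiableAt.congr_of_eventuallyEq
      (eventuallyEq_nhds_of_eventuallyEq_nhdsNE ?_ (Function.update_self _ _ _))
    filter_upwards [hfg, self_mem_nhdsWithin] with w hw hwz
    rw [Function.update_of_ne hwz, hw]
  · refine (hd z hz).congr_of_eventuallyEq ?_
    filter_upwards [isOpen_ne.mem_nhds hz] with w hw using Function.update_of_ne hw _ _

/-- The Laurent tails `∑ (z - p)⁻ᵏ⁻¹ a k`, `k < m`, as a linear function of the coefficients. -/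
def laurentTail (E : Type*) [NormedAddCommGroup E] [NormedSpace ℂ E] (p : ℂ) (m : ℕ) :
    (Fin m → E) →ₗ[ℂ] ℂ → E :=
  LinearMap.pi fun z => ∑ k : Fin m, ((z - p) ^ (k + 1 : ℕ))⁻¹ • LinearMap.proj k

theorem laurentTail_apply {p : ℂ} {m : ℕ} (a : Fin m → E) :
    laurentTail E p m a = ∑ k : Fin m, fun z => ((z - p) ^ (k + 1 : ℕ))⁻¹ • a k := by
  ext z
  simp [laurentTail]

theorem exists_isRegularAt_sub_laurentTail {p : ℂ} {m : ℕ} {f : ℂ → E}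
    (hf : IsRegularAt (fun z => (z - p) ^ m • f z) p) :
    ∃ a, IsRegularAt (f - laurentTail E p m a) p := by
  induction m generalizing f with
  | zero => exact ⟨0, by simpa [laurentTail_apply] using hf⟩
  | succ m ih =>
    obtain ⟨g, ⟨ps, hg⟩, hfg⟩ := hf
    have hslope : (fun z => (z - p) ^ m • (f - fun z => ((z - p) ^ (m + 1))⁻¹ • g p) z)
        =ᶠ[𝓝[≠] p] dslope g p := by
      filter_upwards [hfg, self_mem_nhdsWithin] with z hz hzp
      have hzp' : z - p ≠ 0 := sub_ne_zero.2 hzp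
      have hfz : f z = ((z - p) ^ (m + 1))⁻¹ • g z := by
        rw [← hz, smul_smul, inv_mul_cancel₀ (pow_ne_zero _ hzp'), one_smul]
      rw [dslope_of_ne _ hzp, slope_def_module, Pi.sub_apply, hfz, ← smul_sub, smul_smul]
      congr 1
      field
    obtain ⟨a, ha⟩ := ih ⟨dslope g p, ⟨_, hg.has_fpower_series_dslope_fslope⟩, hslope⟩
    refine ⟨Fin.snoc a (g p), ?_⟩
    rw [laurentTail_apply, Fin.sum_univ_castSucc]
    simpa [laurentTail_apply, sub_sub, add_comm] using ha

theorem finiteDimensional_pole_quotient [FiniteDimensional ℂ E] {p : ℂ} {m : ℕ}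
    {M : Submodule ℂ (ℂ → E)} (hM : ∀ f ∈ M, IsRegularAt (fun z => (z - p) ^ m • f z) p) :
    FiniteDimensional ℂ (M.map (regularAt E p).mkQ) := by
  refine Submodule.finiteDimensional_of_le
    (S₂ := LinearMap.range ((regularAt E p).mkQ ∘ₗ laurentTail E p m)) ?_
  rintro _ ⟨f, hf, rfl⟩
  obtain ⟨a, ha⟩ := exists_isRegularAt_sub_laurentTail (hM f hf)
  exact ⟨a, ((Submodule.Quotient.eq _).2 ha).symm⟩

end Regular

/-! ### Polar sums -/

section Polar

variable {E F : Type*} [NormedAddCommGroup E] [NormedSpace ℂ E]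
  [NormedAddCommGroup F] [NormedSpace ℂ F]

theorem polarSums_mono {V W : Set ℂ} (h : V ⊆ W) : polarSums V E ≤ polarSums W E := by
  apply Submodule.span_mono
  rintro s ⟨p, hp, k, a, rfl⟩
  exact ⟨p, h hp, k, a, rfl⟩

theorem inv_pow_smul_mem_polarSums {V : Set ℂ} {p : ℂ} (hp : p ∈ V) (k : ℕ) (a : E) :
    (fun σ => ((σ - p) ^ (k + 1))⁻¹ • a) ∈ polarSums V E :=
  Submodule.subset_span ⟨p, hp, k, a, rfl⟩

theorem polarSums_empty : polarSums (∅ : Set ℂ) E = ⊥ := by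
  rw [polarSums, Submodule.span_eq_bot]
  rintro s ⟨p, hp, -⟩
  exact hp.elim

theorem polarSums_union (V W : Set ℂ) :
    polarSums (V ∪ W) E = polarSums V E ⊔ polarSums W E := by
  apply le_antisymm
  · refine Submodule.span_le.2 ?_
    rintro s ⟨p, hp | hp, k, a, rfl⟩
    · exact Submodule.mem_sup_left (inv_pow_smul_mem_polarSums hp k a)
    · exact Submodule.mem_sup_right (inv_pow_smul_mem_polarSums hp k a)
  · exact sup_le (polarSums_mono subset_union_left) (polarSums_mono subset_union_right)

theorem analyticAt_of_mem_polarSums {V : Set ℂ} {s : ℂ → E} (hs : s ∈ polarSums V E) {p : ℂ}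
    (hp : p ∉ V) : AnalyticAt ℂ s p := by
  induction hs using Submodule.span_induction with
  | mem s h =>
    obtain ⟨q, hq, k, a, rfl⟩ := h
    have hpq : p - q ≠ 0 := sub_ne_zero.2 fun h => hp (h ▸ hq)
    exact (((analyticAt_id.sub analyticAt_const).pow _).inv (pow_ne_zero _ hpq)).smul
      analyticAt_const
  | zero => exact analyticAt_const
  | add s t _ _ hs ht => exact hs.add ht
  | smul c s _ hs => exact hs.const_smul

theorem meromorphicAt_of_mem_polarSums {V : Set ℂ} {s : ℂ → E} (hs : s ∈ polarSums V E) (p : ℂ) :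
    MeromorphicAt s p := by
  induction hs using Submodule.span_induction with
  | mem s h =>
    obtain ⟨q, _, k, a, rfl⟩ := h
    exact (((MeromorphicAt.id p).sub (MeromorphicAt.const q p)).pow (k + 1)).inv.smul
      (MeromorphicAt.const a p)
  | zero => exact MeromorphicAt.const 0 p
  | add s t _ _ hs ht => exact hs.add ht
  | smul c s _ hs => exact (MeromorphicAt.const c p).smul hs

theorem tendsto_zero_of_mem_polarSums {V : Set ℂ} {s : ℂ → E} (hs : s ∈ polarSums V E) :
    Tendsto s (cocompact ℂ) (𝓝 0) := by
  induction hs using Submodule.span_induction with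
  | mem s h =>
    obtain ⟨q, _, k, a, rfl⟩ := h
    have hsub : Tendsto (fun σ : ℂ => σ - q) (cocompact ℂ) (cocompact ℂ) :=
      (Homeomorph.subRight q).isClosedEmbedding.tendsto_cocompact
    rw [← Metric.cobounded_eq_cocompact] at hsub ⊢
    simpa using (((tendsto_inv₀_cobounded (α := ℂ)).comp hsub).pow (k + 1)).smul_const a
  | zero => exact tendsto_const_nhds
  | add s t _ _ hs ht => simpa [Pi.add_def] using hs.add ht
  | smul c s _ hs => simpa [Pi.smul_def] using hs.const_smul c

theorem apply_eq_zero_of_mem_polarSums_singleton {p : ℂ} {s : ℂ → E}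
    (hs : s ∈ polarSums {p} E) : s p = 0 := by
  induction hs using Submodule.span_induction with
  | mem s h =>
    obtain ⟨q, rfl, k, a, rfl⟩ := h
    simp
  | zero => rfl
  | add s t _ _ hs ht => simp [hs, ht]
  | smul c s _ hs => simp [hs]

theorem eq_zero_of_mem_polarSums_singleton {p : ℂ} {s : ℂ → E}
    (hs : s ∈ polarSums {p} E) (hr : IsRegularAt s p) : s = 0 := by
  obtain ⟨v, hv⟩ := hr.exists_differentiable_update
    fun z hz => (analyticAt_of_mem_polarSums hs hz).differentiableAt
  have hlim : Tendsto (Function.update s p v) (cocompact ℂ) (𝓝 0) := by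
    refine (tendsto_zero_of_mem_polarSums hs).congr' ?_
    filter_upwards [(isCompact_singleton (x := p)).compl_mem_cocompact] with w hw
      using (Function.update_of_ne hw _ _).symm
  ext z
  rcases eq_or_ne z p with rfl | hz
  · exact apply_eq_zero_of_mem_polarSums_singleton hs
  · simpa [Function.update_of_ne hz] using hv.apply_eq_of_tendsto_cocompact z hlim

theorem mem_polarSums_diff_singleton {V : Set ℂ} {s : ℂ → E}
    (hs : s ∈ polarSums V E) {p : ℂ} (hr : IsRegularAt s p) : s ∈ polarSums (V \ {p}) E := by
  have hs' : s ∈ polarSums ({p} ∪ V \ {p}) E :=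
    polarSums_mono (by rw [union_sdiff_self]; exact subset_union_right) hs
  rw [polarSums_union, Submodule.mem_sup] at hs'
  obtain ⟨a, ha, b, hb, rfl⟩ := hs'
  have hb' : AnalyticAt ℂ b p := analyticAt_of_mem_polarSums hb (by simp)
  have ha0 : a = 0 := eq_zero_of_mem_polarSums_singleton ha (by
    simpa using hr.sub (IsRegularAt.of_analyticAt hb'))
  simpa [ha0] using hb

theorem exists_finset_of_mem_polarSums {V : Set ℂ} {s : ℂ → E} (hs : s ∈ polarSums V E) :
    ∃ T : Finset ℂ, ↑T ⊆ V ∧ s ∈ polarSums (T : Set ℂ) E := by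
  classical
  induction hs using Submodule.span_induction with
  | mem s h =>
    obtain ⟨q, hq, k, a, rfl⟩ := h
    exact ⟨{q}, by simpa using hq, inv_pow_smul_mem_polarSums (by simp) k a⟩
  | zero => exact ⟨∅, by simp, zero_mem _⟩
  | add s t _ _ hs ht =>
    obtain ⟨T₁, hT₁, hs⟩ := hs
    obtain ⟨T₂, hT₂, ht⟩ := ht
    exact ⟨T₁ ∪ T₂, by simpa using ⟨hT₁, hT₂⟩, add_mem (polarSums_mono (by simp) hs)
      (polarSums_mono (by simp) ht)⟩
  | smul c s _ hs =>
    obtain ⟨T, hT, hs⟩ := hs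
    exact ⟨T, hT, Submodule.smul_mem _ c hs⟩

theorem exists_finset_poles {V : Set ℂ} {s : ℂ → E} (hs : s ∈ polarSums V E) :
    ∃ T : Finset ℂ, ↑T ⊆ V ∧ s ∈ polarSums (T : Set ℂ) E ∧ ∀ p ∈ T, ¬ IsRegularAt s p := by
  classical
  obtain ⟨T, hTV, hT⟩ := exists_finset_of_mem_polarSums hs
  induction T using Finset.strongInduction with
  | H T ih =>
    by_cases! hreg : ∃ p ∈ T, IsRegularAt s p
    · obtain ⟨p, hp, hsp⟩ := hreg
      refine ih (T.erase p) (Finset.erase_ssubset hp)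
        ((Finset.coe_subset.2 (T.erase_subset p)).trans hTV) ?_
      simpa using mem_polarSums_diff_singleton hT hsp
    · exact ⟨T, hTV, hT, hreg⟩

theorem mem_polarSums_of_regular {V W : Set ℂ} {s : ℂ → E}
    (hs : s ∈ polarSums V E) (hr : ∀ p ∈ V, p ∉ W → IsRegularAt s p) : s ∈ polarSums W E := by
  obtain ⟨T, hTV, hT, hpole⟩ := exists_finset_poles hs
  refine polarSums_mono (fun p hp => ?_) hT
  by_contra hpW
  exact hpole p hp (hr p (hTV hp) hpW)

theorem eq_zero_of_mem_polarSums_of_regular {V : Set ℂ} {s : ℂ → E}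
    (hs : s ∈ polarSums V E) (hr : ∀ p ∈ V, IsRegularAt s p) : s = 0 := by
  have := mem_polarSums_of_regular (W := ∅) hs fun p hp _ => hr p hp
  rwa [polarSums_empty, Submodule.mem_bot] at this

theorem eq_zero_of_mem_polarSums_of_eqOn_open {V O : Set ℂ} {s : ℂ → E}
    (hs : s ∈ polarSums V E) (hO : IsOpen O) (hne : O.Nonempty) (h0 : EqOn s 0 O) : s = 0 := by
  obtain ⟨T, -, hs⟩ := exists_finset_of_mem_polarSums hs
  have hT := T.countable_toSet
  have hconn : IsPreconnected (T : Set ℂ)ᶜ := (hT.isConnected_compl_of_one_lt_rank (by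
    rw [Complex.rank_real_complex]; norm_num)).isPreconnected
  obtain ⟨z, hzO, hzT⟩ := (hT.dense_compl ℝ).inter_open_nonempty O hO hne
  have hcompl : EqOn s 0 (T : Set ℂ)ᶜ :=
    AnalyticOnNhd.eqOn_zero_of_preconnected_of_eventuallyEq_zero
      (fun w hw => analyticAt_of_mem_polarSums hs hw) hconn hzT
      (h0.eventuallyEq_of_mem (hO.mem_nhds hzO))
  exact eq_zero_of_mem_polarSums_of_regular hs fun p _ =>
    ⟨0, analyticAt_const, (eventually_notMem_of_finite T.finite_toSet p).mono fun z hz => hcompl hz⟩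

theorem exists_mem_polarSums_singleton {p : ℂ} {m : ℕ} {f : ℂ → E}
    (hf : IsRegularAt (fun z => (z - p) ^ m • f z) p) :
    ∃ s ∈ polarSums {p} E, IsRegularAt (f - s) p := by
  obtain ⟨a, ha⟩ := exists_isRegularAt_sub_laurentTail hf
  refine ⟨_, ?_, ha⟩
  rw [laurentTail_apply]
  exact Submodule.sum_mem _ fun k _ => inv_pow_smul_mem_polarSums (mem_singleton p) k (a k)

theorem exists_mem_polarSums_of_finite {Z : Set ℂ} (hZ : Z.Finite) {f : ℂ → E}
    (hf : ∀ p ∈ Z, ∃ m : ℕ, IsRegularAt (fun z => (z - p) ^ m • f z) p) :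
    ∃ s ∈ polarSums Z E, ∀ p ∈ Z, IsRegularAt (f - s) p := by
  choose! m hm using hf
  choose! t ht htr using fun p hp => exists_mem_polarSums_singleton (hm p hp)
  refine ⟨∑ p ∈ hZ.toFinset, t p, Submodule.sum_mem _ fun p hp => ?_, fun p hp => ?_⟩
  · have hp' : p ∈ Z := by simpa using hp
    exact polarSums_mono (singleton_subset_iff.2 hp') (ht p hp')
  · rw [← Finset.add_sum_erase _ _ (hZ.mem_toFinset.2 hp), ← sub_sub]
    refine (htr p hp).sub (IsRegularAt.of_analyticAt (Finset.analyticAt_sum _ fun q hq => ?_))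
    simp only [Finset.mem_erase, Finite.mem_toFinset] at hq
    exact analyticAt_of_mem_polarSums (ht q hq.2) hq.1.symm

theorem mem_kernelSpace_iff [CompleteSpace F] {S : Set ℂ} (hS : IsOpen S) {A : ℂ → E →L[ℂ] F}
    (hA : DifferentiableOn ℂ A S) {s : ℂ → E} :
    s ∈ kernelSpace S A ↔ s ∈ polarSums S E ∧ ∀ p ∈ S, IsRegularAt (fun σ => A σ (s σ)) p := by
  constructor
  · rintro ⟨φ, -, hφ, hs, hr⟩
    refine ⟨hs, fun p hp => ?_⟩
    simpa [Pi.sub_def] using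
      (hφ p hp).sub ((hr p hp).clm_apply (hA.analyticAt (hS.mem_nhds hp)))
  · rintro ⟨hs, hr⟩
    refine ⟨s, fun p _ => meromorphicAt_of_mem_polarSums hs p, hr, hs, fun p _ => ?_⟩
    rw [sub_self]
    exact IsRegularAt.zero p

end Polar

/-! ### Analytic Fredholm theory at a point -/

section Fredholm

variable {E F : Type*} [NormedAddCommGroup E] [NormedSpace ℂ E]
  [NormedAddCommGroup F] [NormedSpace ℂ F]

/-- `T` becomes invertible after the addition of an operator that factors through a
finite-dimensional space. This is the only consequence of `T` being a Fredholm operator of index `0`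
that the analytic Fredholm theory below needs. -/
def HasFiniteRankCorrection (T : E →L[ℂ] F) : Prop :=
  ∃ (N : ℕ) (C : E →L[ℂ] (Fin N → ℂ)) (B : (Fin N → ℂ) →L[ℂ] F), (T + B ∘L C).IsInvertible

theorem HasFiniteRankCorrection.of_isFredholm {T : E →L[ℂ] F} (hT : T.IsFredholm)
    (h0 : (T : E →ₗ[ℂ] F).index = 0) : HasFiniteRankCorrection T := by
  obtain ⟨pkg⟩ := hT.nonempty_fredholmPackage
  let X := pkg.decDom
  let Z := pkg.decCodom
  have := X.finite_X₀
  have := Z.finite_X₀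
  have hdim : Module.finrank ℂ X.X₀ = Module.finrank ℂ Z.X₀ := by
    rw [LinearMap.index_eq_finrank_sub, pkg.ker_eq, pkg.range_eq,
      (Submodule.quotientEquivOfIsCompl _ _ Z.isTopCompl.isCompl).finrank_eq,
      sub_eq_zero] at h0
    exact_mod_cast h0
  let eX : X.X₀ ≃L[ℂ] (Fin (Module.finrank ℂ X.X₀) → ℂ) := .ofFinrankEq (by simp)
  let eZ : (Fin (Module.finrank ℂ X.X₀) → ℂ) ≃L[ℂ] Z.X₀ := .ofFinrankEq (by simp [hdim])
  refine ⟨Module.finrank ℂ X.X₀,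
    (eX : _ →L[ℂ] _) ∘L X.X₀.projectionOntoL X.X₁ X.isTopCompl.symm,
    Z.X₀.subtypeL ∘L (eZ : (Fin (Module.finrank ℂ X.X₀) → ℂ) →L[ℂ] Z.X₀),
    (X.X₁.prodEquivOfIsTopCompl X.X₀ X.isTopCompl).symm.trans
      ((pkg.equiv.prodCongr (eX.trans eZ)).trans
        (Z.X₁.prodEquivOfIsTopCompl Z.X₀ Z.isTopCompl)), ?_⟩
  ext x
  simp [X, Z, DFunLike.congr_fun pkg.eq_equiv x]

theorem analyticAt_inverse [CompleteSpace E] {A : ℂ → E →L[ℂ] F} {p : ℂ} (hA : AnalyticAt ℂ A p)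
    (hp : (A p).IsInvertible) : AnalyticAt ℂ (fun z => (A z).inverse) p :=
  (hp.contDiffAt_map_inverse (n := ω)).analyticAt.comp hA

theorem eventually_isInvertible [CompleteSpace E] {X : Type*} {l : Filter X} {A : X → E →L[ℂ] F}
    {T : E →L[ℂ] F} (hT : T.IsInvertible) (h : Tendsto A l (𝓝 T)) :
    ∀ᶠ x in l, (A x).IsInvertible := by
  obtain ⟨e, rfl⟩ := hT
  exact h.eventually e.nhds

theorem isRegularAt_of_isInvertible [CompleteSpace E] {A : ℂ → E →L[ℂ] F} {p : ℂ}
    (hA : AnalyticAt ℂ A p) (hp : (A p).IsInvertible) {f : ℂ → E}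
    (hf : IsRegularAt (fun z => A z (f z)) p) : IsRegularAt f p := by
  refine (hf.clm_apply (analyticAt_inverse hA hp)).congr ?_
  filter_upwards [(eventually_isInvertible hp hA.continuousAt).filter_mono nhdsWithin_le_nhds]
    with z hz using hz.inverse_apply_self _

theorem analyticAt_det {ι : Type*} [Fintype ι] [DecidableEq ι] {Q : ℂ → Matrix ι ι ℂ} {p : ℂ}
    (hQ : ∀ i j, AnalyticAt ℂ (fun z => Q z i j) p) : AnalyticAt ℂ (fun z => (Q z).det) p := by
  simp_rw [Matrix.det_apply']
  exact Finset.analyticAt_fun_sum _ fun τ _ => analyticAt_const.mul <|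
    Finset.analyticAt_fun_prod _ fun i _ => hQ _ _

theorem analyticAt_cramer {ι : Type*} [Fintype ι] [DecidableEq ι] {Q : ℂ → Matrix ι ι ℂ}
    {w : ℂ → ι → ℂ} {p : ℂ} (hQ : ∀ i j, AnalyticAt ℂ (fun z => Q z i j) p)
    (hw : AnalyticAt ℂ w p) : AnalyticAt ℂ (fun z => (Q z).cramer (w z)) p := by
  refine analyticAt_pi_iff.2 fun i => ?_
  simp only [Matrix.cramer_apply]
  refine analyticAt_det fun a b => ?_
  simp only [Matrix.updateCol_apply]
  split_ifs
  · exact analyticAt_pi_iff.1 hw a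
  · exact hQ a b

/-- Cramer's rule: the inverse of a holomorphic matrix has a pole of finite order wherever the
determinant has an isolated zero. -/
theorem exists_pow_smul_isRegularAt_of_mulVec {ι : Type*} [Fintype ι] [DecidableEq ι]
    {Q : ℂ → Matrix ι ι ℂ} {p : ℂ} (hQ : ∀ i j, AnalyticAt ℂ (fun z => Q z i j) p)
    (hdet : ∀ᶠ z in 𝓝[≠] p, (Q z).det ≠ 0) :
    ∃ m : ℕ, ∀ v : ℂ → ι → ℂ, IsRegularAt (fun z => (Q z).mulVec (v z)) p →
      IsRegularAt (fun z => (z - p) ^ m • v z) p := by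
  obtain ⟨m, hm⟩ := (analyticAt_det hQ).meromorphicAt.inv
  refine ⟨m, fun v ⟨w, hw, hvw⟩ => ⟨_, hm.smul (analyticAt_cramer hQ hw), ?_⟩⟩
  filter_upwards [hvw, hdet] with z hz hz'
  rw [Pi.smul_apply', ← hz, Matrix.cramer_eq_adjugate_mulVec, Matrix.mulVec_mulVec,
    Matrix.adjugate_mul, Matrix.smul_mulVec, Matrix.one_mulVec, smul_assoc, Pi.inv_apply,
    inv_smul_smul₀ hz']

section Correction

variable {A : ℂ → E →L[ℂ] F} {p : ℂ} {N : ℕ} {C : E →L[ℂ] (Fin N → ℂ)}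
  {B : (Fin N → ℂ) →L[ℂ] F}

theorem injective_one_sub_of_isInvertible {T : E →L[ℂ] F} (hT : T.IsInvertible)
    (hBC : (T + B ∘L C).IsInvertible) :
    Function.Injective fun v => v - C ((T + B ∘L C).inverse (B v)) := by
  refine (injective_iff_map_eq_zero (1 - C ∘L (T + B ∘L C).inverse ∘L B :
    (Fin N → ℂ) →L[ℂ] (Fin N → ℂ))).2 fun v hv => ?_
  set x := (T + B ∘L C).inverse (B v)
  have hv : v = C x := sub_eq_zero.1 hv
  have hx : T x + B (C x) = B v := hBC.self_apply_inverse (B v)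
  rw [← hv, add_eq_right] at hx
  rw [hv, ← hT.inverse_apply_self x, hx, map_zero, map_zero]

variable [CompleteSpace E]

theorem isRegularAt_of_correction (hA : AnalyticAt ℂ A p) (hBC : (A p + B ∘L C).IsInvertible)
    {f : ℂ → E} (hf : IsRegularAt (fun z => A z (f z)) p) (hC : IsRegularAt (fun z => C (f z)) p) :
    IsRegularAt f p :=
  isRegularAt_of_isInvertible (hA.add analyticAt_const) hBC (hf.add (hC.const_clm_apply B))

/-- With `R = (A + BC)⁻¹`, the component `C f` solves the finite system
`(1 - C R B) (C f) = C R (A f)`, to which Cramer's rule applies. -/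
theorem exists_pow_smul_correction_isRegularAt (hA : AnalyticAt ℂ A p)
    (hinv : ∀ᶠ z in 𝓝[≠] p, (A z).IsInvertible) (hBC : (A p + B ∘L C).IsInvertible) :
    ∃ m : ℕ, ∀ f : ℂ → E, IsRegularAt (fun z => A z (f z)) p →
      IsRegularAt (fun z => (z - p) ^ m • C (f z)) p := by
  have hABC : AnalyticAt ℂ (fun z => A z + B ∘L C) p := hA.add analyticAt_const
  have hR := analyticAt_inverse hABC hBC
  have hRinv : ∀ᶠ z in 𝓝[≠] p, (A z + B ∘L C).IsInvertible :=
    (eventually_isInvertible hBC hABC.continuousAt).filter_mono nhdsWithin_le_nhds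
  set R : ℂ → F →L[ℂ] E := fun z => (A z + B ∘L C).inverse
  let Q : ℂ → Matrix (Fin N) (Fin N) ℂ := fun z =>
    LinearMap.toMatrix' ((1 - C ∘L R z ∘L B : (Fin N → ℂ) →L[ℂ] (Fin N → ℂ)) : _ →ₗ[ℂ] _)
  have hQv : ∀ z v, (Q z).mulVec v = v - C (R z (B v)) := fun z v => LinearMap.toMatrix'_mulVec _ _
  have hQ : ∀ i j, AnalyticAt ℂ (fun z => Q z i j) p := fun i j => by
    have hcol : AnalyticAt ℂ (fun z => (Q z).mulVec (Pi.single j 1)) p := by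
      simp_rw [hQv]
      exact analyticAt_const.sub <| analyticAt_clm_apply analyticAt_const <|
        analyticAt_clm_apply hR analyticAt_const
    simpa using analyticAt_pi_iff.1 hcol i
  have hdet : ∀ᶠ z in 𝓝[≠] p, (Q z).det ≠ 0 := by
    filter_upwards [hinv, hRinv] with z hz hz'
    rw [← isUnit_iff_ne_zero, ← Matrix.isUnit_iff_isUnit_det, ← Matrix.mulVec_injective_iff_isUnit,
      show (Q z).mulVec = _ from funext (hQv z)]
    exact injective_one_sub_of_isInvertible hz hz'
  obtain ⟨m, hm⟩ := exists_pow_smul_isRegularAt_of_mulVec hQ hdet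
  refine ⟨m, fun f hf => hm _ (((hf.clm_apply hR).const_clm_apply C).congr ?_)⟩
  filter_upwards [hRinv] with z hz
  have hz : R z (A z (f z)) + R z (B (C (f z))) = f z := by
    rw [← map_add]
    exact hz.inverse_apply_self (f z)
  rw [hQv, eq_sub_iff_add_eq, ← map_add, hz]

theorem exists_pow_smul_isRegularAt (hA : AnalyticAt ℂ A p)
    (hinv : ∀ᶠ z in 𝓝[≠] p, (A z).IsInvertible) (hcorr : HasFiniteRankCorrection (A p)) :
    ∃ m : ℕ, ∀ f : ℂ → E, IsRegularAt (fun z => A z (f z)) p →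
      IsRegularAt (fun z => (z - p) ^ m • f z) p := by
  obtain ⟨N, C, B, hBC⟩ := hcorr
  obtain ⟨m, hm⟩ := exists_pow_smul_correction_isRegularAt hA hinv hBC
  exact ⟨m, fun f hf => isRegularAt_of_correction hA hBC (by simpa using hf.pow_smul m)
    (by simpa using hm f hf)⟩

end Correction

/-- A holomorphic family of operators on `S` that are Fredholm of index `0`, in the form of
`HasFiniteRankCorrection`, and invertible except at finitely many points. -/
structure IsFredholmOn (S : Set ℂ) (A : ℂ → E →L[ℂ] F) : Prop where
  differentiableOn : DifferentiableOn ℂ A S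
  correction : ∀ p ∈ S, HasFiniteRankCorrection (A p)
  finite : (singPts S A).Finite

section IsFredholmOn

variable {S : Set ℂ} {A : ℂ → E →L[ℂ] F}

theorem isInvertible_of_notMem_singPts {p : ℂ} (hp : p ∈ S) (hpA : p ∉ singPts S A) :
    (A p).IsInvertible := by
  by_contra h
  exact hpA ⟨hp, h⟩

theorem IsFredholmOn.eventually_isInvertible (hS : IsOpen S) (hA : IsFredholmOn S A) {p : ℂ}
    (hp : p ∈ S) : ∀ᶠ z in 𝓝[≠] p, (A z).IsInvertible := by
  filter_upwards [eventually_notMem_of_finite hA.finite p,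
    mem_nhdsWithin_of_mem_nhds (hS.mem_nhds hp)] with z hz hzS
    using isInvertible_of_notMem_singPts hzS hz

variable [CompleteSpace E] [CompleteSpace F]

theorem IsFredholmOn.mem_polarSums (hS : IsOpen S) (hA : IsFredholmOn S A) {s : ℂ → E}
    (hs : s ∈ kernelSpace S A) : s ∈ polarSums (singPts S A) E := by
  obtain ⟨hs, hr⟩ := (mem_kernelSpace_iff hS hA.differentiableOn).1 hs
  exact mem_polarSums_of_regular hs fun p hp hpA => isRegularAt_of_isInvertible
    (hA.differentiableOn.analyticAt (hS.mem_nhds hp)) (isInvertible_of_notMem_singPts hp hpA)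
    (hr p hp)

/-- The polar part at `p` of an element `s` of the kernel space is determined by that of the
finite-dimensional component `C s`, whose pole order is bounded. -/
theorem IsFredholmOn.finiteDimensional_kernelSpace (hS : IsOpen S) (hA : IsFredholmOn S A) :
    FiniteDimensional ℂ (kernelSpace S A) := by
  have hreg (s : kernelSpace S A) := ((mem_kernelSpace_iff hS hA.differentiableOn).1 s.2).2
  have han {p : ℂ} (hp : p ∈ S) := hA.differentiableOn.analyticAt (hS.mem_nhds hp)
  choose! N C B hBC using hA.correction
  let Φ (p : singPts S A) : kernelSpace S A →ₗ[ℂ] (ℂ → Fin (N p) → ℂ) ⧸ regularAt _ (p : ℂ) :=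
    (regularAt (Fin (N p) → ℂ) p).mkQ ∘ₗ
      ((C p : E →ₗ[ℂ] (Fin (N p) → ℂ)).compLeft ℂ) ∘ₗ (kernelSpace S A).subtype
  have hfin (p : singPts S A) : FiniteDimensional ℂ (Φ p).range := by
    obtain ⟨m, hm⟩ := exists_pow_smul_correction_isRegularAt (han p.2.1)
      (hA.eventually_isInvertible hS p.2.1) (hBC p p.2.1)
    rw [LinearMap.range_comp]
    refine finiteDimensional_pole_quotient (m := m) ?_
    rintro _ ⟨s, rfl⟩
    exact hm _ (hreg s p p.2.1)
  have := hA.finite.to_subtype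
  refine FiniteDimensional.of_injective (V₂ := ∀ p, (Φ p).range)
    (LinearMap.pi fun p => (Φ p).rangeRestrict)
    ((injective_iff_map_eq_zero _).2 fun s hs => Subtype.ext ?_)
  refine eq_zero_of_mem_polarSums_of_regular (hA.mem_polarSums hS s.2) fun p hp => ?_
  have hCs : Φ ⟨p, hp⟩ s = 0 := congrArg Subtype.val (congrFun hs ⟨p, hp⟩)
  exact isRegularAt_of_correction (han hp.1) (hBC p hp.1) (hreg s p hp.1)
    ((Submodule.Quotient.mk_eq_zero _).1 hCs)

end IsFredholmOn

end Fredholm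

/-! ### Holomorphic functions on a compact set -/

section HoloSpace

variable {E F : Type*} [NormedAddCommGroup E] [NormedSpace ℂ E]
  [NormedAddCommGroup F] [NormedSpace ℂ F] {K : Set ℂ}

/-- The extension by zero of the continuous functions on `K`. It allows holomorphy in the interior
of `K` to be expressed by `DifferentiableOn`. -/
def extendZero (K : Set ℂ) (E : Type*) [NormedAddCommGroup E] [NormedSpace ℂ E] :
    C(K, E) →ₗ[ℂ] ℂ → E where
  toFun f := Function.extend Subtype.val f 0
  map_add' f g := by
    rw [← Function.extend_add, add_zero]
    rfl
  map_smul' c f := by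
    rw [RingHom.id_apply, ← Function.extend_smul, smul_zero]
    rfl

theorem extendZero_coe (f : C(K, E)) (x : K) : extendZero K E f x = f x :=
  Subtype.val_injective.extend_apply f 0 x

theorem continuousOn_extendZero (f : C(K, E)) : ContinuousOn (extendZero K E f) K := by
  rw [continuousOn_iff_continuous_domRestrict]
  exact f.continuous.congr fun x => (extendZero_coe f x).symm

/-- The space of the continuous functions on `K` that are holomorphic in the interior of `K`; its
elements are applied to points of `ℂ` by means of `extendZero`. -/
def holoSpace (K : Set ℂ) (E : Type*) [NormedAddCommGroup E] [NormedSpace ℂ E] :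
    Submodule ℂ C(K, E) where
  carrier := {f | DifferentiableOn ℂ (extendZero K E f) (interior K)}
  add_mem' hf hg := by simpa using hf.add hg
  zero_mem' := by simp
  smul_mem' c f hf := by simpa using hf.const_smul c

instance : CoeFun (holoSpace K E) fun _ => ℂ → E :=
  ⟨fun f => extendZero K E f⟩

theorem exists_holoSpace_eqOn {f : ℂ → E} (hc : ContinuousOn f K)
    (hd : DifferentiableOn ℂ f (interior K)) : ∃ g : holoSpace K E, EqOn g f K := by
  let g : C(K, E) := ⟨K.domRestrict f, continuousOn_iff_continuous_domRestrict.1 hc⟩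
  have hg : EqOn (extendZero K E g) f K := fun z hz => extendZero_coe g ⟨z, hz⟩
  exact ⟨⟨g, hd.congr (hg.mono interior_subset)⟩, hg⟩

theorem holoSpace_differentiableAt (f : holoSpace K E) {z : ℂ} (hz : z ∈ interior K) :
    DifferentiableAt ℂ f z :=
  f.2.differentiableAt (isOpen_interior.mem_nhds hz)

theorem holoSpace_analyticAt [CompleteSpace E] (f : holoSpace K E) {z : ℂ} (hz : z ∈ interior K) :
    AnalyticAt ℂ f z :=
  DifferentiableOn.analyticAt f.2 (isOpen_interior.mem_nhds hz)

theorem eventually_mem_diff_of_mem_interior {Z : Set ℂ} (hZ : Z.Finite) {p : ℂ}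
    (hp : p ∈ interior K) : ∀ᶠ z in 𝓝[≠] p, z ∈ K \ Z := by
  filter_upwards [eventually_notMem_of_finite hZ p,
    mem_nhdsWithin_of_mem_nhds (mem_interior_iff_mem_nhds.1 hp)] with z hz hzK using ⟨hzK, hz⟩

theorem holoSpace_ext {Z : Set ℂ} (hZ : Z.Finite) (hZK : Z ⊆ interior K) {f g : holoSpace K E}
    (h : EqOn f g (K \ Z)) : f = g := by
  refine Subtype.ext (ContinuousMap.ext fun ⟨z, hz⟩ => ?_)
  rw [← extendZero_coe, ← extendZero_coe]
  by_cases hzZ : z ∈ Z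
  · exact tendsto_nhds_unique_of_eventuallyEq
      (holoSpace_differentiableAt f (hZK hzZ)).continuousAt.continuousWithinAt
      (holoSpace_differentiableAt g (hZK hzZ)).continuousAt.continuousWithinAt
      ((eventually_mem_diff_of_mem_interior hZ (hZK hzZ)).mono h)
  · exact h ⟨hz, hzZ⟩

theorem exists_holoSpace_eqOn_of_regular {Z : Set ℂ} (hZ : Z.Finite) {f : ℂ → E}
    (hc : ∀ z ∈ K \ Z, ContinuousWithinAt f K z)
    (hd : ∀ z ∈ interior K \ Z, DifferentiableAt ℂ f z) (hr : ∀ z ∈ Z, IsRegularAt f z) :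
    ∃ g : holoSpace K E, EqOn g f (K \ Z) := by
  classical
  choose! G hG hfG using hr
  let f' : ℂ → E := fun z => if z ∈ Z then G z z else f z
  have hf' {z : ℂ} (hz : z ∉ Z) : f' z = f z := if_neg hz
  have h_notMem {z : ℂ} (hz : z ∉ Z) : f' =ᶠ[𝓝 z] f := by
    filter_upwards [hZ.isClosed.isOpen_compl.mem_nhds hz] with w hw using hf' hw
  have h_mem {z : ℂ} (hz : z ∈ Z) : f' =ᶠ[𝓝 z] G z :=
    eventuallyEq_nhds_of_eventuallyEq_nhdsNE (EventuallyEq.trans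
      ((eventually_notMem_of_finite hZ z).mono fun w hw => hf' hw) (hfG z hz)) (if_pos hz)
  obtain ⟨g, hg⟩ := exists_holoSpace_eqOn (K := K) (f := f')
    (fun z hz => by
      by_cases hzZ : z ∈ Z
      · exact ((hG z hzZ).continuousAt.congr (h_mem hzZ).symm).continuousWithinAt
      · exact (hc z ⟨hz, hzZ⟩).congr_of_eventuallyEq
          ((h_notMem hzZ).filter_mono nhdsWithin_le_nhds) (hf' hzZ))
    (fun z hz => by
      by_cases hzZ : z ∈ Z
      · exact ((hG z hzZ).differentiableAt.congr_of_eventuallyEq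
          (h_mem hzZ)).differentiableWithinAt
      · exact ((hd z ⟨hz, hzZ⟩).congr_of_eventuallyEq (h_notMem hzZ)).differentiableWithinAt)
  exact ⟨g, fun z hz => (hg hz.1).trans (hf' hz.2)⟩

/-- The pointwise application of an operator-valued function to a function. -/
def holoApply (a : holoSpace K (E →L[ℂ] F)) (u : holoSpace K E) : holoSpace K F :=
  ⟨⟨fun x => a.1 x (u.1 x), a.1.continuous.clm_apply u.1.continuous⟩,
    (DifferentiableOn.clm_apply a.2 u.2).congr fun z hz => by
      lift z to K using interior_subset hz
      simp only [extendZero_coe, ContinuousMap.coe_mk]⟩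

theorem holoApply_apply (a : holoSpace K (E →L[ℂ] F)) (u : holoSpace K E) {z : ℂ} (hz : z ∈ K) :
    holoApply a u z = a z (u z) := by
  lift z to K using hz
  simp only [extendZero_coe]
  rfl

section Compact

variable [CompactSpace K]

theorem isClosed_holoSpace [CompleteSpace E] : IsClosed (holoSpace K E : Set C(K, E)) := by
  refine isSeqClosed_iff_isClosed.1 fun f g hf hfg => ?_
  have hunif : TendstoUniformlyOn (fun n => extendZero K E (f n)) (extendZero K E g) atTop
      (interior K) := fun u hu => by
    filter_upwards [ContinuousMap.tendsto_iff_tendstoUniformly.1 hfg u hu] with n hn z hz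
    simpa only [← extendZero_coe] using hn ⟨z, interior_subset hz⟩
  exact hunif.tendstoLocallyUniformlyOn.differentiableOn (Eventually.of_forall hf) isOpen_interior

instance [CompleteSpace E] : CompleteSpace (holoSpace K E) :=
  isClosed_holoSpace.completeSpace_coe

/-- `holoApply` as a bounded bilinear map. -/
def holoMul : holoSpace K (E →L[ℂ] F) →L[ℂ] holoSpace K E →L[ℂ] holoSpace K F :=
  LinearMap.mkContinuous₂
    (LinearMap.mk₂ ℂ holoApply
      (fun a b u => Subtype.ext (ContinuousMap.ext fun x => rfl))
      (fun c a u => Subtype.ext (ContinuousMap.ext fun x => rfl))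
      (fun a u v => Subtype.ext (ContinuousMap.ext fun x => map_add (a.1 x) _ _))
      (fun c a u => Subtype.ext (ContinuousMap.ext fun x => map_smul (a.1 x) _ _))) 1
    (fun a u => by
      rw [one_mul]
      refine (ContinuousMap.norm_le _ (by positivity)).2 fun x => ?_
      exact (a.1 x).le_of_opNorm_le_of_le (a.1.norm_coe_le_norm x) (u.1.norm_coe_le_norm x))

theorem holoMul_apply (a : holoSpace K (E →L[ℂ] F)) (u : holoSpace K E) :
    holoMul a u = holoApply a u :=
  rfl

end Compact

section KernelEquiv

variable [CompleteSpace E] [CompleteSpace F] {S : Set ℂ} {A : ℂ → E →L[ℂ] F}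

theorem exists_kernelSpace_sub_regular (hS : IsOpen S) (hA : IsFredholmOn S A) {f : ℂ → E}
    (hf : ∀ p ∈ singPts S A, IsRegularAt (fun z => A z (f z)) p) :
    ∃ s ∈ kernelSpace S A, ∀ p ∈ singPts S A, IsRegularAt (f - s) p := by
  have han {p : ℂ} (hp : p ∈ S) := hA.differentiableOn.analyticAt (hS.mem_nhds hp)
  obtain ⟨s, hs, hfs⟩ := exists_mem_polarSums_of_finite hA.finite (f := f) fun p hp => by
    obtain ⟨m, hm⟩ := exists_pow_smul_isRegularAt (han hp.1) (hA.eventually_isInvertible hS hp.1)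
      (hA.correction p hp.1)
    exact ⟨m, hm f (hf p hp)⟩
  refine ⟨s, (mem_kernelSpace_iff hS hA.differentiableOn).2
    ⟨polarSums_mono (fun p hp => hp.1) hs, fun p hpS => ?_⟩, hfs⟩
  by_cases hp : p ∈ singPts S A
  · refine ((hf p hp).sub ((hfs p hp).clm_apply (han hpS))).congr (.of_forall fun z => ?_)
    simp
  · exact (IsRegularAt.of_analyticAt (analyticAt_of_mem_polarSums hs hp)).clm_apply (han hpS)

theorem eq_zero_of_add_eq_zero (hS : IsOpen S) (hA : IsFredholmOn S A)
    (hK : singPts S A ⊆ interior K) {u : holoSpace K E} {s : kernelSpace S A}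
    (h : ∀ z ∈ K \ singPts S A, u z + s.1 z = 0) : u = 0 ∧ s = 0 := by
  have hs : s = 0 := by
    refine Subtype.ext (eq_zero_of_mem_polarSums_of_regular (hA.mem_polarSums hS s.2)
      fun p hp => ⟨-u, (holoSpace_analyticAt u (hK hp)).neg, ?_⟩)
    filter_upwards [eventually_mem_diff_of_mem_interior hA.finite (hK hp)] with z hz
    exact eq_neg_of_add_eq_zero_right (h z hz)
  refine ⟨holoSpace_ext hA.finite hK fun z hz => ?_, hs⟩
  simpa [hs] using h z hz

theorem exists_holoSpace_eqOn_apply_add (hS : IsOpen S) (hA : IsFredholmOn S A) (hKS : K ⊆ S)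
    (hK : singPts S A ⊆ interior K) (u : holoSpace K E) (s : kernelSpace S A) :
    ∃ h : holoSpace K F, EqOn h (fun z => A z (u z + s.1 z)) (K \ singPts S A) := by
  have han {z : ℂ} (hz : z ∈ S) := hA.differentiableOn.analyticAt (hS.mem_nhds hz)
  have hs {z : ℂ} (hz : z ∉ singPts S A) : AnalyticAt ℂ s.1 z :=
    analyticAt_of_mem_polarSums (hA.mem_polarSums hS s.2) hz
  refine exists_holoSpace_eqOn_of_regular hA.finite (fun z hz => ?_) (fun z hz => ?_)
    fun z hz => ?_
  · exact (han (hKS hz.1)).continuousAt.continuousWithinAt.clm_apply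
      ((continuousOn_extendZero u.1 z hz.1).add (hs hz.2).continuousAt.continuousWithinAt)
  · exact (han (hKS (interior_subset hz.1))).differentiableAt.clm_apply
      ((holoSpace_differentiableAt u hz.1).add (hs hz.2).differentiableAt)
  · have hu := (IsRegularAt.of_analyticAt (holoSpace_analyticAt u (hK hz))).clm_apply (han hz.1)
    refine (hu.add (((mem_kernelSpace_iff hS hA.differentiableOn).1 s.2).2 z hz.1)).congr
      (.of_forall fun w => ?_)
    exact (map_add (A w) _ _).symm

theorem exists_eqOn_apply_add (hS : IsOpen S) (hA : IsFredholmOn S A) (hKS : K ⊆ S)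
    (hK : singPts S A ⊆ interior K) (h : holoSpace K F) :
    ∃ (u : holoSpace K E) (s : kernelSpace S A),
      EqOn h (fun z => A z (u z + s.1 z)) (K \ singPts S A) := by
  let f : ℂ → E := fun z => (A z).inverse (h z)
  have hAf {z : ℂ} (hz : z ∈ K \ singPts S A) : A z (f z) = h z :=
    (isInvertible_of_notMem_singPts (hKS hz.1) hz.2).self_apply_inverse _
  have hinv {z : ℂ} (hz : z ∈ K \ singPts S A) : AnalyticAt ℂ (fun z => (A z).inverse) z :=
    analyticAt_inverse (hA.differentiableOn.analyticAt (hS.mem_nhds (hKS hz.1)))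
      (isInvertible_of_notMem_singPts (hKS hz.1) hz.2)
  obtain ⟨s, hs, hfs⟩ := exists_kernelSpace_sub_regular hS hA (f := f) fun p hp =>
    (IsRegularAt.of_analyticAt (holoSpace_analyticAt h (hK hp))).congr
      ((eventually_mem_diff_of_mem_interior hA.finite (hK hp)).mono fun z hz => (hAf hz).symm)
  have hsan {z : ℂ} (hz : z ∉ singPts S A) : AnalyticAt ℂ s z :=
    analyticAt_of_mem_polarSums (hA.mem_polarSums hS hs) hz
  obtain ⟨u, hu⟩ := exists_holoSpace_eqOn_of_regular (K := K) hA.finite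
    (fun z hz => ((hinv hz).continuousAt.continuousWithinAt.clm_apply
      (continuousOn_extendZero h.1 z hz.1)).sub (hsan hz.2).continuousAt.continuousWithinAt)
    (fun z hz => ((hinv ⟨interior_subset hz.1, hz.2⟩).differentiableAt.clm_apply
      (holoSpace_differentiableAt h hz.1)).sub (hsan hz.2).differentiableAt) hfs
  refine ⟨u, ⟨s, hs⟩, fun z hz => ?_⟩
  dsimp only
  rw [hu hz, Pi.sub_apply, sub_add_cancel, hAf hz]

/-- `(u, s) ↦ A (u + s)` is an isomorphism; both sides are compared in the space of all functions
on `K \ singPts S A`. -/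
theorem exists_kernelEquiv (hS : IsOpen S) (hA : IsFredholmOn S A) (hKS : K ⊆ S)
    (hK : singPts S A ⊆ interior K) :
    ∃ M : (holoSpace K E × kernelSpace S A) ≃ₗ[ℂ] holoSpace K F, ∀ u s,
      EqOn (M (u, s)) (fun z => A z (u z + s.1 z)) (K \ singPts S A) := by
  let ρ : holoSpace K F →ₗ[ℂ] ↥(K \ singPts S A) → F :=
    LinearMap.pi fun z => .proj (z : ℂ) ∘ₗ extendZero K F ∘ₗ (holoSpace K F).subtype
  let Λ : holoSpace K E × kernelSpace S A →ₗ[ℂ] ↥(K \ singPts S A) → F :=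
    LinearMap.pi fun z => (A z : E →ₗ[ℂ] F) ∘ₗ .proj (z : ℂ) ∘ₗ
      (extendZero K E ∘ₗ (holoSpace K E).subtype).coprod (kernelSpace S A).subtype
  have hρ : Function.Injective ρ := fun f g hfg =>
    holoSpace_ext hA.finite hK fun z hz => congrFun hfg ⟨z, hz⟩
  have hΛ : Function.Injective Λ := (injective_iff_map_eq_zero Λ).2 fun ⟨u, s⟩ hus => by
    refine Prod.ext_iff.2 (eq_zero_of_add_eq_zero hS hA hK fun z hz => ?_)
    have hinv := isInvertible_of_notMem_singPts (hKS hz.1) hz.2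
    exact hinv.injective ((congrFun hus ⟨z, hz⟩).trans (map_zero (A z)).symm)
  have hrange : Λ.range = ρ.range := by
    refine le_antisymm ?_ ?_
    · rintro _ ⟨⟨u, s⟩, rfl⟩
      obtain ⟨h, hh⟩ := exists_holoSpace_eqOn_apply_add hS hA hKS hK u s
      exact ⟨h, funext fun z => hh z.2⟩
    · rintro _ ⟨h, rfl⟩
      obtain ⟨u, s, hus⟩ := exists_eqOn_apply_add hS hA hKS hK h
      exact ⟨(u, s), funext fun z => (hus z.2).symm⟩
  let e := LinearEquiv.ofInjective ρ hρ
  let M := LinearEquiv.ofInjective Λ hΛ ≪≫ₗ LinearEquiv.ofEq _ _ hrange ≪≫ₗ e.symm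
  refine ⟨M, fun u s z hz => ?_⟩
  have hM : ρ (M (u, s)) = Λ (u, s) := congrArg Subtype.val (e.apply_symm_apply _)
  exact congrFun hM ⟨z, hz⟩

end KernelEquiv

end HoloSpace

/-! ### Stability of bases -/

section Stability

variable {E F : Type*} [NormedAddCommGroup E] [NormedSpace ℂ E]
  [NormedAddCommGroup F] [NormedSpace ℂ F]

/-- In the coordinates of `M`, the operator `(v, x) ↦ M (v, 0) + g x` is triangular. -/
theorem bijective_coprod_iff {R U V W X : Type*} [Ring R] [AddCommGroup U] [AddCommGroup V]
    [AddCommGroup W] [AddCommGroup X] [Module R U] [Module R V] [Module R W] [Module R X]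
    (M : (V × W) ≃ₗ[R] U) (g : X →ₗ[R] U) :
    Function.Bijective ((M.toLinearMap ∘ₗ .inl R V W).coprod g) ↔
      Function.Bijective (LinearMap.snd R V W ∘ₗ M.symm.toLinearMap ∘ₗ g) := by
  have htri : M.symm ∘ (M.toLinearMap ∘ₗ .inl R V W).coprod g =
      fun p : V × X => (p.1 + (M.symm (g p.2)).1, (M.symm (g p.2)).2) := by
    ext p <;> simp
  rw [← M.symm.bijective.of_comp_iff', htri]
  refine ⟨fun ⟨hi, hs⟩ => ⟨fun x y hxy => ?_, fun w => ?_⟩,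
    fun ⟨hi, hs⟩ => ⟨fun p q hpq => ?_, fun w => ?_⟩⟩
  · have hxy : (M.symm (g x)).2 = (M.symm (g y)).2 := hxy
    have : ((-(M.symm (g x)).1, x) : V × X) = (-(M.symm (g y)).1, y) := hi (by simp [hxy])
    exact (Prod.mk.inj this).2
  · obtain ⟨p, hp⟩ := hs (0, w)
    exact ⟨p.2, (Prod.mk.inj hp).2⟩
  · obtain ⟨h₁, h₂⟩ := Prod.mk.inj hpq
    have hpq₂ : p.2 = q.2 := hi h₂
    rw [hpq₂] at h₁
    exact Prod.ext (add_right_cancel h₁) hpq₂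
  · obtain ⟨x, hx⟩ := hs w.2
    exact ⟨(w.1 - (M.symm (g x)).1, x), Prod.ext (sub_add_cancel _ _) hx⟩

theorem continuous_of_eqOn_holoSpace {Z : Type*} [TopologicalSpace Z] {K : Set ℂ} {f : Z → ℂ → E}
    (hf : ContinuousOn (fun p : Z × ℂ => f p.1 p.2) (univ ×ˢ K)) {a : Z → holoSpace K E}
    (ha : ∀ z, EqOn (a z) (f z) K) : Continuous a := by
  refine continuous_induced_rng.2 (ContinuousMap.continuous_of_continuous_uncurry _ ?_)
  refine (hf.comp_continuous (f := fun p : Z × K => (p.1, (p.2 : ℂ))) (by fun_prop)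
    fun p => ⟨mem_univ _, p.2.2⟩).congr fun p => ?_
  exact (ha p.1 p.2.2).symm.trans (extendZero_coe _ _)

theorem isInvertible_iff_bijective [CompleteSpace E] [CompleteSpace F] {T : E →L[ℂ] F} :
    T.IsInvertible ↔ Function.Bijective T := by
  refine ⟨fun h => h.bijective, fun h => ⟨.ofBijective T (LinearMap.ker_eq_bot.2 h.1)
    (LinearMap.range_eq_top.2 h.2), ContinuousLinearEquiv.coe_ofBijective _ _ _⟩⟩

variable [CompleteSpace E] [CompleteSpace F]

/-- If `h j` is the image of `(0, b j)` under the isomorphism of `exists_kernelEquiv` at `z₀`, with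
`b` a basis of the kernel space at `z₀`, then the kernel components of the preimages of `h` form a
basis exactly when `(u, c) ↦ A z u + ∑ j, c j • h j` is invertible, which is an open condition. -/
theorem exists_stable_basis {Z : Type*} [TopologicalSpace Z] {S K : Set ℂ} (hS : IsOpen S)
    (hKc : IsCompact K) (hKS : K ⊆ S) {A : Z → ℂ → E →L[ℂ] F}
    (hcont : ContinuousOn (fun p : Z × ℂ => A p.1 p.2) (univ ×ˢ S))
    (hA : ∀ z, IsFredholmOn S (A z)) (hK : ∀ z, singPts S (A z) ⊆ interior K) (z₀ : Z) :
    ∃ (r : ℕ) (h : Fin r → holoSpace K F) (s : ∀ z, Fin r → kernelSpace S (A z)),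
      (∀ z j, ∃ u : holoSpace K E,
        EqOn (h j) (fun w => A z w (u w + (s z j).1 w)) (K \ singPts S (A z))) ∧
      ∀ᶠ z in 𝓝 z₀, Function.Bijective (Fintype.linearCombination ℂ (s z)) := by
  have : CompactSpace K := isCompact_iff_compactSpace.1 hKc
  have := (hA z₀).finiteDimensional_kernelSpace hS
  choose M hM using fun z => exists_kernelEquiv hS (hA z) hKS (hK z)
  choose a ha using fun z => exists_holoSpace_eqOn (K := K) (f := A z)
    ((hA z).differentiableOn.continuousOn.mono hKS)
    ((hA z).differentiableOn.mono (interior_subset.trans hKS))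
  have hac : Continuous a := continuous_of_eqOn_holoSpace (hcont.mono (prod_mono_right hKS)) ha
  let b := Module.finBasis ℂ (kernelSpace S (A z₀))
  let h : Fin _ → holoSpace K F := fun j => M z₀ (0, b j)
  let s : ∀ z, Fin _ → kernelSpace S (A z) := fun z j => ((M z).symm (h j)).2
  let T : Z → (holoSpace K E × (Fin _ → ℂ)) →L[ℂ] holoSpace K F := fun z =>
    (holoMul (a z)).coprod (Fintype.linearCombination ℂ h).toContinuousLinearMap
  have hT (z : Z) :
      (T z).IsInvertible ↔ Function.Bijective (Fintype.linearCombination ℂ (s z)) := by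
    have hmul : (holoMul (a z) : holoSpace K E →ₗ[ℂ] holoSpace K F) =
        (M z).toLinearMap ∘ₗ .inl ℂ _ _ := LinearMap.ext fun u =>
      holoSpace_ext (hA z).finite (hK z) fun w hw => by
        simp [holoMul_apply, holoApply_apply _ _ hw.1, ha z hw.1, hM z u 0 hw]
    have hlin : LinearMap.snd ℂ _ _ ∘ₗ (M z).symm.toLinearMap ∘ₗ Fintype.linearCombination ℂ h =
        Fintype.linearCombination ℂ (s z) := by
      ext j
      simp [s]
    rw [isInvertible_iff_bijective, ← hlin, ← bijective_coprod_iff, ← hmul]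
    rfl
  refine ⟨_, h, s, fun z j => ⟨((M z).symm (h j)).1, fun w hw => ?_⟩, ?_⟩
  · have hMs : M z (((M z).symm (h j)).1, s z j) = h j := (M z).apply_symm_apply (h j)
    exact (congrArg (fun f : holoSpace K F => f w) hMs).symm.trans (hM z _ _ hw)
  have hs₀ : s z₀ = b := funext fun j => by simp [s, h]
  have hT₀ : (T z₀).IsInvertible := by
    rw [hT, hs₀]
    exact ⟨linearIndependent_iff_injective_fintypeLinearCombination.1 b.linearIndependent,
      LinearMap.range_eq_top.1 ((Fintype.range_linearCombination ℂ _).trans b.span_eq)⟩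
  have hTc : Continuous T :=
    (holoMul.continuous.comp hac).continuousLinearMapCoprod continuous_const
  exact (eventually_isInvertible hT₀ hTc.continuousAt).mono fun z => (hT z).1

end Stability

/-! ### Smooth operations on functions with values in complex normed spaces -/

section Smooth

variable {X : Type*} [NormedAddCommGroup X] [NormedSpace ℝ X] {H : Type*} [TopologicalSpace H]
  {I : ModelWithCorners ℝ X H} {M : Type*} [TopologicalSpace M] [ChartedSpace H M]
  {E F : Type*} [NormedAddCommGroup E] [NormedSpace ℂ E] [NormedAddCommGroup F] [NormedSpace ℂ F]

theorem contMDiffAt_complex_smul {c : M → ℂ} {v : M → E} {x : M}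
    (hc : ContMDiffAt I 𝓘(ℝ, ℂ) ∞ c x) (hv : ContMDiffAt I 𝓘(ℝ, E) ∞ v x) :
    ContMDiffAt I 𝓘(ℝ, E) ∞ (fun x => c x • v x) x := by
  have h : ContDiff ℝ ∞ (fun p : ℂ × E => p.1 • p.2) :=
    (contDiff_smul (𝕜 := ℂ)).restrict_scalars ℝ
  exact h.contDiffAt.comp_contMDiffAt (hc.prodMk_space hv)

theorem contMDiffAt_complex_clm_apply {T : M → E →L[ℂ] F} {v : M → E} {x : M}
    (hT : ContMDiffAt I 𝓘(ℝ, E →L[ℂ] F) ∞ T x) (hv : ContMDiffAt I 𝓘(ℝ, E) ∞ v x) :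
    ContMDiffAt I 𝓘(ℝ, F) ∞ (fun x => T x (v x)) x := by
  have h : ContDiff ℝ ∞ (fun p : (E →L[ℂ] F) × E => p.1 p.2) :=
    (isBoundedBilinearMap_apply (𝕜 := ℂ)).contDiff.restrict_scalars ℝ
  exact h.contDiffAt.comp_contMDiffAt (hT.prodMk_space hv)

theorem contMDiffAt_clm_inverse [CompleteSpace E] {T : M → E →L[ℂ] F} {x : M}
    (hT : ContMDiffAt I 𝓘(ℝ, E →L[ℂ] F) ∞ T x) (hx : (T x).IsInvertible) :
    ContMDiffAt I 𝓘(ℝ, F →L[ℂ] E) ∞ (fun x => (T x).inverse) x :=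
  ((hx.contDiffAt_map_inverse (n := ∞)).restrict_scalars ℝ).comp_contMDiffAt hT

theorem contMDiffAt_const_clm_apply (L : E →L[ℂ] F) {v : M → E} {x : M}
    (hv : ContMDiffAt I 𝓘(ℝ, E) ∞ v x) : ContMDiffAt I 𝓘(ℝ, F) ∞ (fun x => L (v x)) x :=
  (L.contDiff.restrict_scalars ℝ).contDiffAt.comp_contMDiffAt hv

end Smooth

/-! ### Smooth dependence of contour integrals on parameters -/

section Parametric

open MeasureTheory

theorem contDiffOn_intervalIntegral {P E : Type*} [NormedAddCommGroup P] [NormedSpace ℝ P]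
    [NormedAddCommGroup E] [NormedSpace ℝ E] {f : P → ℝ → E} {W : Set P} {n : ℕ∞}
    (hW : IsOpen W) (hf : ContDiffOn ℝ n ↿f (W ×ˢ univ)) (a b : ℝ) :
    ContDiffOn ℝ n (fun x => ∫ t in a..b, f x t) W := by
  wlog hab : a ≤ b generalizing a b
  · simp_rw [intervalIntegral.integral_symm b a]
    exact (this b a (le_of_not_ge hab)).neg
  let χ : ContDiffBump (0 : ℝ) := ⟨max |a| |b| + 1, max |a| |b| + 2, by positivity, by linarith⟩
  have hχ : ∀ t ∈ Ioc a b, χ (-t) = 1 := fun t ht => χ.one_of_mem_closedBall <| by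
    rw [Metric.mem_closedBall, dist_zero_right, norm_neg]
    exact (abs_le_max_abs_abs ht.1.le ht.2).trans (le_add_of_nonneg_right zero_le_one)
  -- The integral is the value at `0` of the convolution of an indicator function with a cutoff of
  -- `t ↦ f x (-t)`.
  have hconv := contDiffOn_convolution_right_with_param (μ := volume) (n := n)
    (f := (Ioc a b).indicator (1 : ℝ → ℝ)) (g := fun x t => χ t • f x (-t))
    (ContinuousLinearMap.lsmul ℝ ℝ) hW (isCompact_closedBall 0 χ.rOut)
    (fun x t _ ht => by rw [χ.zero_of_le_dist (not_le.1 ht).le, zero_smul])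
    ((integrable_indicator_iff measurableSet_Ioc).2 <|
      integrableOn_const (by simp)).locallyIntegrable
    ((χ.contDiff.comp contDiff_snd).contDiffOn.smul <|
      hf.comp (contDiff_fst.prodMk contDiff_snd.neg).contDiffOn fun p hp => ⟨hp.1, mem_univ _⟩)
  refine (hconv.comp (contDiff_id.prodMk (contDiff_const (c := (0 : ℝ)))).contDiffOn
    fun x hx => ⟨hx, mem_univ _⟩).congr fun x _ => ?_
  rw [intervalIntegral.integral_of_le hab, ← integral_indicator measurableSet_Ioc]
  refine integral_congr_ae (.of_forall fun t => ?_)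
  by_cases ht : t ∈ Ioc a b <;> simp [ht, hχ]

theorem contDiffAt_circleIntegral {P E : Type*} [NormedAddCommGroup P] [NormedSpace ℝ P]
    [NormedAddCommGroup E] [NormedSpace ℂ E] {f : P × ℂ → E} {G : Set (P × ℂ)} {n : ℕ∞}
    (hG : IsOpen G) (hf : ContDiffOn ℝ n f G) {c : ℂ} {R : ℝ} (hR : 0 ≤ R) {x₀ : P}
    (h : ∀ ζ ∈ Metric.sphere c R, (x₀, ζ) ∈ G) :
    ContDiffAt ℝ n (fun x => ∮ ζ in C(c, R), f (x, ζ)) x₀ := by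
  obtain ⟨U, V, hU, -, hxU, hV, hUV⟩ := generalized_tube_lemma (isCompact_singleton (x := x₀))
    (isCompact_sphere c R) hG (by rintro ⟨_, ζ⟩ ⟨rfl, hζ⟩; exact h ζ hζ)
  refine (contDiffOn_intervalIntegral hU ?_ 0 (2 * Real.pi)).contDiffAt (hU.mem_nhds (hxU rfl))
  have hcircle : ContDiff ℝ n fun p : P × ℝ => (p.1, circleMap c R p.2) :=
    contDiff_fst.prodMk ((contDiff_circleMap c R).comp contDiff_snd)
  have hderiv : ContDiff ℝ n fun p : P × ℝ => deriv (circleMap c R) p.2 := by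
    simp only [deriv_circleMap]
    exact ((contDiff_circleMap 0 R).comp contDiff_snd).mul contDiff_const
  exact hderiv.contDiffOn.smul (hf.comp hcircle.contDiffOn fun p hp =>
    hUV ⟨hp.1, hV (circleMap_mem_sphere c hR p.2)⟩)

theorem contMDiffAt_circleIntegral {P H M E : Type*} [NormedAddCommGroup P] [NormedSpace ℝ P]
    [TopologicalSpace H] {I : ModelWithCorners ℝ P H} [I.Boundaryless] [TopologicalSpace M]
    [ChartedSpace H M] {n : ℕ∞} [IsManifold I n M] [NormedAddCommGroup E] [NormedSpace ℂ E]
    {f : M × ℂ → E} {G : Set (M × ℂ)} (hG : IsOpen G)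
    (hf : ContMDiffOn (I.prod 𝓘(ℝ, ℂ)) 𝓘(ℝ, E) n f G) {c : ℂ} {R : ℝ} (hR : 0 ≤ R) {x₀ : M}
    (h : ∀ ζ ∈ Metric.sphere c R, (x₀, ζ) ∈ G) :
    ContMDiffAt I 𝓘(ℝ, E) n (fun x => ∮ ζ in C(c, R), f (x, ζ)) x₀ := by
  let φ := extChartAt I x₀
  let Ψ : P × ℂ → M × ℂ := fun p => (φ.symm p.1, p.2)
  have hΨ : ContMDiffOn 𝓘(ℝ, P × ℂ) (I.prod 𝓘(ℝ, ℂ)) n Ψ (φ.target ×ˢ univ) :=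
    ((contMDiffOn_extChartAt_symm x₀).comp contDiff_fst.contMDiff.contMDiffOn
      fun p hp => hp.1).prodMk contDiff_snd.contMDiff.contMDiffOn
  have hG' : IsOpen ((φ.target ×ˢ univ) ∩ Ψ ⁻¹' G) :=
    hΨ.continuousOn.isOpen_inter_preimage ((isOpen_extChartAt_target x₀).prod isOpen_univ) hG
  have hf' : ContDiffOn ℝ n (f ∘ Ψ) ((φ.target ×ˢ univ) ∩ Ψ ⁻¹' G) :=
    contMDiffOn_iff_contDiffOn.1 (hf.comp (hΨ.mono inter_subset_left) fun p hp => hp.2)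
  have hφx : φ.symm (φ x₀) = x₀ := extChartAt_to_inv x₀
  have hint := contDiffAt_circleIntegral hG' hf' hR (x₀ := φ x₀) (c := c) fun ζ hζ =>
    ⟨⟨mem_extChartAt_target x₀, mem_univ _⟩, by simpa only [mem_preimage, Ψ, hφx] using h ζ hζ⟩
  refine (hint.contMDiffAt.comp x₀ contMDiffAt_extChartAt).congr_of_eventuallyEq ?_
  filter_upwards [extChartAt_source_mem_nhds (I := I) x₀] with x hx
  simp only [Function.comp_apply, Ψ, φ.left_inv hx]

end Parametric

/-! ### Cauchy's formula for polar sums -/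

section Cauchy

variable {E : Type*} [NormedAddCommGroup E] [NormedSpace ℂ E]

theorem continuousOn_inv_sub {c σ : ℂ} {R : ℝ} (hσ : σ ∉ Metric.closedBall c R) :
    ContinuousOn (fun ζ => (σ - ζ)⁻¹) (Metric.closedBall c R) :=
  (continuousOn_const.sub continuousOn_id).inv₀ fun ζ hζ =>
    sub_ne_zero.2 fun h : σ = ζ => hσ (h ▸ hζ)

theorem circleIntegral_inv_sub_smul_eq_zero {c σ : ℂ} {R : ℝ} (hR : 0 ≤ R)
    (hσ : σ ∉ Metric.closedBall c R) {u : ℂ → E}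
    (hu : ∀ z ∈ Metric.closedBall c R, DifferentiableAt ℂ u z) :
    (∮ ζ in C(c, R), (σ - ζ)⁻¹ • u ζ) = 0 :=
  Complex.circleIntegral_eq_zero_of_differentiable_on_off_countable hR countable_empty
    ((continuousOn_inv_sub hσ).smul fun z hz => (hu z hz).continuousAt.continuousWithinAt)
    fun z hz => (((differentiableAt_const σ).sub differentiableAt_id).inv
      (sub_ne_zero.2 fun h : σ = z => hσ (h ▸ Metric.ball_subset_closedBall hz.1))).smul
        (hu z (Metric.ball_subset_closedBall hz.1))

theorem circleIntegral_inv_sub_mul_pow_succ {c p σ : ℂ} {R : ℝ} (hp : p ∈ Metric.ball c R)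
    (hσ : σ ∉ Metric.closedBall c R) (m : ℕ) :
    (∮ ζ in C(c, R), (σ - ζ)⁻¹ * ((ζ - p) ^ (m + 1))⁻¹) =
      (σ - p)⁻¹ * ((∮ ζ in C(c, R), ((ζ - p) ^ (m + 1))⁻¹) +
        ∮ ζ in C(c, R), (σ - ζ)⁻¹ * ((ζ - p) ^ m)⁻¹) := by
  have hR : 0 ≤ R := (Metric.pos_of_mem_ball hp).le
  have hσp : σ - p ≠ 0 := sub_ne_zero.2 fun h => hσ (h ▸ Metric.ball_subset_closedBall hp)
  have hζσ : ∀ ζ ∈ Metric.sphere c R, σ - ζ ≠ 0 := fun ζ hζ =>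
    sub_ne_zero.2 fun h => hσ (h ▸ Metric.sphere_subset_closedBall hζ)
  have hζp : ∀ ζ ∈ Metric.sphere c R, ζ - p ≠ 0 := fun ζ hζ => sub_ne_zero.2 fun h =>
    (Metric.mem_ball.1 hp).ne (h ▸ Metric.mem_sphere.1 hζ)
  have hpow (k : ℕ) : ContinuousOn (fun ζ => ((ζ - p) ^ k)⁻¹) (Metric.sphere c R) :=
    ((continuousOn_id.sub continuousOn_const).pow k).inv₀ fun ζ hζ => pow_ne_zero _ (hζp ζ hζ)
  have hinv := (continuousOn_inv_sub hσ).mono Metric.sphere_subset_closedBall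
  have hint : CircleIntegrable (fun ζ => (σ - ζ)⁻¹ * ((ζ - p) ^ m)⁻¹) c R :=
    (hinv.mul (hpow m)).circleIntegrable hR
  rw [← circleIntegral.integral_add ((hpow _).circleIntegrable hR) hint,
    ← circleIntegral.integral_const_mul]
  refine circleIntegral.integral_congr hR fun ζ hζ => ?_
  have := hζp ζ hζ
  have := hζσ ζ hζ
  field_simp
  ring

theorem circleIntegral_inv_sub_mul_pow {c p σ : ℂ} {R : ℝ} (hp : p ∈ Metric.ball c R)
    (hσ : σ ∉ Metric.closedBall c R) (k : ℕ) :
    (∮ ζ in C(c, R), (σ - ζ)⁻¹ * ((ζ - p) ^ (k + 1))⁻¹) =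
      2 * Real.pi * Complex.I * ((σ - p) ^ (k + 1))⁻¹ := by
  rw [circleIntegral_inv_sub_mul_pow_succ hp hσ]
  induction k with
  | zero =>
    have h0 := circleIntegral_inv_sub_smul_eq_zero (Metric.pos_of_mem_ball hp).le hσ
      fun z _ => differentiableAt_const (1 : ℂ)
    simp only [smul_eq_mul, mul_one] at h0
    simp only [zero_add, pow_one, pow_zero, inv_one, mul_one, h0, add_zero,
      circleIntegral.integral_sub_inv_of_mem_ball hp, mul_comm]
  | succ k ih =>
    have h0 : (∮ ζ in C(c, R), ((ζ - p) ^ (k + 1 + 1))⁻¹) = 0 := by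
      simpa only [zpow_neg, zpow_natCast] using
        circleIntegral.integral_sub_zpow_of_ne (n := -((k + 1 + 1 : ℕ) : ℤ)) (by omega) c p R
    rw [h0, circleIntegral_inv_sub_mul_pow_succ hp hσ, ih, pow_succ _ (k + 1), mul_inv]
    ring

/-- The Cauchy integral of `f` over the circles of radius `δ` around the points of `Z`, for points
`σ` outside these circles. With the kernel `(σ - ζ)⁻¹` instead of `(ζ - σ)⁻¹`, it recovers from `f`
its singular part inside the circles. -/
def exteriorCauchy (Z : Finset ℂ) (δ : ℝ) (f : ℂ → E) (σ : ℂ) : E :=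
  ∑ q ∈ Z, (2 * Real.pi * Complex.I : ℂ)⁻¹ • ∮ ζ in C(q, δ), (σ - ζ)⁻¹ • f ζ

theorem exteriorCauchy_add {Z : Finset ℂ} {δ : ℝ} (hδ : 0 ≤ δ) {f g : ℂ → E}
    (hf : ∀ q ∈ Z, ContinuousOn f (Metric.sphere q δ))
    (hg : ∀ q ∈ Z, ContinuousOn g (Metric.sphere q δ)) {σ : ℂ}
    (hσ : ∀ q ∈ Z, σ ∉ Metric.closedBall q δ) :
    exteriorCauchy Z δ (f + g) σ = exteriorCauchy Z δ f σ + exteriorCauchy Z δ g σ := by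
  simp only [exteriorCauchy, ← Finset.sum_add_distrib, ← smul_add]
  refine Finset.sum_congr rfl fun q hq => congrArg _ ?_
  have hinv := (continuousOn_inv_sub (hσ q hq)).mono Metric.sphere_subset_closedBall
  simp only [Pi.add_apply, smul_add]
  exact circleIntegral.integral_add ((hinv.smul (hf q hq)).circleIntegrable hδ)
    ((hinv.smul (hg q hq)).circleIntegrable hδ)

theorem exteriorCauchy_congr {Z : Finset ℂ} {δ : ℝ} (hδ : 0 ≤ δ) {f g : ℂ → E}
    (hfg : ∀ q ∈ Z, EqOn f g (Metric.sphere q δ)) (σ : ℂ) :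
    exteriorCauchy Z δ f σ = exteriorCauchy Z δ g σ :=
  Finset.sum_congr rfl fun q hq => congrArg _ <|
    circleIntegral.integral_congr hδ fun _ hζ => congrArg _ (hfg q hq hζ)

theorem exteriorCauchy_smul (Z : Finset ℂ) (δ : ℝ) (c : ℂ) (f : ℂ → E) (σ : ℂ) :
    exteriorCauchy Z δ (c • f) σ = c • exteriorCauchy Z δ f σ := by
  simp only [exteriorCauchy, Finset.smul_sum, smul_comm c, ← circleIntegral.integral_smul,
    Pi.smul_apply]

theorem exteriorCauchy_eq_zero {Z : Finset ℂ} {δ : ℝ} (hδ : 0 ≤ δ) {u : ℂ → E}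
    (hu : ∀ q ∈ Z, ∀ z ∈ Metric.closedBall q δ, DifferentiableAt ℂ u z) {σ : ℂ}
    (hσ : ∀ q ∈ Z, σ ∉ Metric.closedBall q δ) : exteriorCauchy Z δ u σ = 0 :=
  Finset.sum_eq_zero fun q hq => by
    rw [circleIntegral_inv_sub_smul_eq_zero hδ (hσ q hq) (hu q hq), smul_zero]

variable [CompleteSpace E]

theorem exteriorCauchy_inv_pow_smul {Z : Finset ℂ} {δ : ℝ} (hδ : 0 ≤ δ)
    (hZ : (Z : Set ℂ).PairwiseDisjoint (Metric.closedBall · δ)) {q₀ p : ℂ} (hq₀ : q₀ ∈ Z)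
    (hp : p ∈ Metric.ball q₀ δ) {σ : ℂ} (hσ : ∀ q ∈ Z, σ ∉ Metric.closedBall q δ) (k : ℕ) (a : E) :
    exteriorCauchy Z δ (fun ζ => ((ζ - p) ^ (k + 1))⁻¹ • a) σ = ((σ - p) ^ (k + 1))⁻¹ • a := by
  rw [exteriorCauchy, Finset.sum_eq_single_of_mem q₀ hq₀ fun q hq hqq => ?_]
  · simp_rw [smul_smul]
    rw [circleIntegral.integral_smul_const, circleIntegral_inv_sub_mul_pow hp (hσ q₀ hq₀),
      smul_smul, inv_mul_cancel_left₀ Complex.two_pi_I_ne_zero]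
  · rw [circleIntegral_inv_sub_smul_eq_zero hδ (hσ q hq) fun z hz => ?_, smul_zero]
    have hzp : z ≠ p := by
      rintro rfl
      exact (hZ hq hq₀ hqq).le_bot ⟨hz, Metric.ball_subset_closedBall hp⟩
    exact ((((differentiableAt_id).sub (differentiableAt_const p)).pow (k + 1)).inv
      (pow_ne_zero _ (sub_ne_zero.2 hzp))).smul (differentiableAt_const a)

theorem notMem_iUnion_ball_of_mem_sphere {Z : Finset ℂ} {δ : ℝ}
    (hZ : (Z : Set ℂ).PairwiseDisjoint (Metric.closedBall · δ)) {q ζ : ℂ} (hq : q ∈ Z)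
    (hζ : ζ ∈ Metric.sphere q δ) : ζ ∉ ⋃ q ∈ Z, Metric.ball q δ := by
  rw [mem_iUnion₂]
  rintro ⟨q', hq', hζ'⟩
  obtain rfl := hZ.elim_set hq hq' ζ (Metric.sphere_subset_closedBall hζ)
    (Metric.ball_subset_closedBall hζ')
  exact (Metric.mem_ball.1 hζ').ne hζ

theorem exteriorCauchy_of_mem_polarSums {Z : Finset ℂ} {δ : ℝ} (hδ : 0 ≤ δ)
    (hZ : (Z : Set ℂ).PairwiseDisjoint (Metric.closedBall · δ)) {s : ℂ → E}
    (hs : s ∈ polarSums (⋃ q ∈ Z, Metric.ball q δ) E) {σ : ℂ}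
    (hσ : ∀ q ∈ Z, σ ∉ Metric.closedBall q δ) : exteriorCauchy Z δ s σ = s σ := by
  have hcont {t : ℂ → E} (ht : t ∈ polarSums (⋃ q ∈ Z, Metric.ball q δ) E) :
      ∀ q ∈ Z, ContinuousOn t (Metric.sphere q δ) := fun q hq ζ hζ =>
    (analyticAt_of_mem_polarSums ht
      (notMem_iUnion_ball_of_mem_sphere hZ hq hζ)).continuousAt.continuousWithinAt
  induction hs using Submodule.span_induction with
  | mem s h =>
    obtain ⟨p, hp, k, a, rfl⟩ := h
    obtain ⟨q₀, hq₀, hp⟩ := mem_iUnion₂.1 hp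
    exact exteriorCauchy_inv_pow_smul hδ hZ hq₀ hp hσ k a
  | zero => exact exteriorCauchy_eq_zero hδ (fun _ _ _ _ => differentiableAt_const 0) hσ
  | add s t hs ht ihs iht =>
    rw [exteriorCauchy_add hδ (hcont hs) (hcont ht) hσ, ihs, iht, Pi.add_apply]
  | smul c s _ ih => rw [exteriorCauchy_smul, ih, Pi.smul_apply]

theorem exteriorCauchy_add_of_mem_polarSums {Z : Finset ℂ} {δ : ℝ} (hδ : 0 ≤ δ)
    (hZ : (Z : Set ℂ).PairwiseDisjoint (Metric.closedBall · δ)) {u s : ℂ → E}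
    (hu : ∀ q ∈ Z, ∀ z ∈ Metric.closedBall q δ, DifferentiableAt ℂ u z)
    (hs : s ∈ polarSums (⋃ q ∈ Z, Metric.ball q δ) E) {σ : ℂ}
    (hσ : ∀ q ∈ Z, σ ∉ Metric.closedBall q δ) : exteriorCauchy Z δ (u + s) σ = s σ := by
  rw [exteriorCauchy_add hδ (fun q hq z hz =>
      (hu q hq z (Metric.sphere_subset_closedBall hz)).continuousAt.continuousWithinAt)
    (fun q hq ζ hζ => (analyticAt_of_mem_polarSums hs
      (notMem_iUnion_ball_of_mem_sphere hZ hq hζ)).continuousAt.continuousWithinAt) hσ,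
    exteriorCauchy_eq_zero hδ hu hσ, exteriorCauchy_of_mem_polarSums hδ hZ hs hσ, zero_add]

end Cauchy

/-! ### Smoothness of coefficients -/

section Coefficients

theorem exists_linearIndependent_comp {𝕜 ι X : Type*} [Field 𝕜] [Finite ι] {g : ι → X → 𝕜}
    (hg : LinearIndependent 𝕜 g) :
    ∃ (N : ℕ) (p : Fin N → X), LinearIndependent 𝕜 fun j => g j ∘ p := by
  obtain ⟨w, hw, hspan, -⟩ := Submodule.exists_fun_fin_finrank_span_eq 𝕜 (range (flip g))
  choose p hp using hw
  refine ⟨_, p, span_flip_eq_top_iff_linearIndependent.1 ?_⟩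
  have hpw : flip (fun j => g j ∘ p) = w := funext hp
  rw [hpw, hspan, span_flip_eq_top_iff_linearIndependent.2 hg]

variable {E : Type*} [NormedAddCommGroup E] [NormedSpace ℂ E] {ι α : Type*}

theorem linearIndependent_dual_apply [Finite ι] {f : ι → α → E} (hf : LinearIndependent ℂ f) :
    LinearIndependent ℂ fun j (p : α × (E →L[ℂ] ℂ)) => p.2 (f j p.1) := by
  cases nonempty_fintype ι
  rw [Fintype.linearIndependent_iff] at hf ⊢
  refine fun c hc => hf c (funext fun a => ?_)
  by_contra hne
  obtain ⟨l, hl⟩ := SeparatingDual.exists_ne_zero (R := ℂ) hne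
  refine hl ?_
  simpa only [Finset.sum_apply, Pi.smul_apply, map_sum, map_smul, Pi.zero_apply] using
    congrFun hc (a, l)

variable [Fintype ι] {X : Type*} [NormedAddCommGroup X] [NormedSpace ℝ X] {H : Type*}
  [TopologicalSpace H] {I : ModelWithCorners ℝ X H} {M : Type*} [TopologicalSpace M]
  [ChartedSpace H M]

/-- Finitely many evaluations of the functions at `x₀` have a left inverse `G`. Composed with the
evaluations at `x` it gives an operator `B x` that is invertible for `x` near `x₀` and takes the
coefficients `c x` to a smooth function of `x`. -/
theorem eventually_contMDiffAt_coefficients {f : M → ι → α → E} {x₀ : M}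
    (hf : ∀ᶠ x in 𝓝 x₀, ∀ j a, ContMDiffAt I 𝓘(ℝ, E) ∞ (fun x => f x j a) x)
    (hli : LinearIndependent ℂ (f x₀)) :
    ∀ᶠ x in 𝓝 x₀, ∀ c : M → ι → ℂ,
      (∀ a, ContMDiffAt I 𝓘(ℝ, E) ∞ (fun x => ∑ j, c x j • f x j a) x) →
      ContMDiffAt I 𝓘(ℝ, ι → ℂ) ∞ c x := by
  obtain ⟨N, p, hp⟩ := exists_linearIndependent_comp (linearIndependent_dual_apply hli)
  let m : M → ι → Fin N → ℂ := fun x j k => (p k).2 (f x j (p k).1)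
  obtain ⟨G, hG⟩ := LinearMap.exists_leftInverse_of_injective (Fintype.linearCombination ℂ (m x₀))
    (LinearMap.ker_eq_bot.2 (linearIndependent_iff_injective_fintypeLinearCombination.1 hp))
  let Φ : (ι → Fin N → ℂ) →L[ℂ] (ι → ℂ) →L[ℂ] (ι → ℂ) :=
    (LinearMap.toContinuousLinearMap.toLinearMap ∘ₗ G.compRight ℂ ∘ₗ
      Fintype.bilinearCombination ℂ ℂ).toContinuousLinearMap
  have hΦ (x : M) (c : ι → ℂ) :
      Φ (m x) c = G fun k => (p k).2 (∑ j, c j • f x j (p k).1) := by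
    refine congrArg G (funext fun k => ?_)
    simp only [m, Fintype.bilinearCombination_apply, Fintype.linearCombination_apply,
      Finset.sum_apply, Pi.smul_apply, map_sum, map_smul]
  have hB : ∀ᶠ x in 𝓝 x₀, ContMDiffAt I 𝓘(ℝ, (ι → ℂ) →L[ℂ] (ι → ℂ)) ∞ (fun x => Φ (m x)) x := by
    filter_upwards [hf] with x hx
    exact contMDiffAt_const_clm_apply Φ (contMDiffAt_pi_space.2 fun j =>
      contMDiffAt_pi_space.2 fun k => contMDiffAt_const_clm_apply (p k).2 (hx j (p k).1))
  have hB₀ : (Φ (m x₀)).IsInvertible :=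
    ⟨.refl ℂ _, ContinuousLinearMap.ext fun c => (LinearMap.congr_fun hG c).symm⟩
  filter_upwards [hB, eventually_isInvertible hB₀ hB.self_of_nhds.continuousAt] with x hx hxi c hc
  have hBc : ContMDiffAt I 𝓘(ℝ, ι → ℂ) ∞ (fun x => Φ (m x) (c x)) x := by
    simp only [hΦ]
    exact contMDiffAt_const_clm_apply G.toContinuousLinearMap
      (contMDiffAt_pi_space.2 fun k => contMDiffAt_const_clm_apply (p k).2 (hc (p k).1))
  refine (contMDiffAt_complex_clm_apply (contMDiffAt_clm_inverse hx hxi) hBc).congr_of_eventuallyEq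
    ((eventually_isInvertible hxi hx.continuousAt).mono fun y hy => ?_)
  exact (hy.inverse_apply_self _).symm

end Coefficients

/-! ### Local frames of the kernel bundle in trivializations -/

section LocalFrame

theorem exists_isolating_radius {X : Type*} [MetricSpace X] {Z : Set X} (hZ : Z.Finite) {W : Set X}
    (hW : IsOpen W) (hZW : Z ⊆ W) : ∃ δ > 0, (∀ q ∈ Z, Metric.closedBall q δ ⊆ W) ∧
      Z.PairwiseDisjoint (Metric.closedBall · δ) := by
  have hsub : ∀ᶠ δ in 𝓝[>] (0 : ℝ), ∀ q ∈ Z, Metric.closedBall q δ ⊆ W :=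
    (eventually_all_finite hZ).2 fun q hq =>
      (eventually_closedBall_subset (hW.mem_nhds (hZW hq))).filter_mono nhdsWithin_le_nhds
  have hdisj : ∀ᶠ δ in 𝓝[>] (0 : ℝ), ∀ q ∈ Z, ∀ q' ∈ Z, q ≠ q' →
      Disjoint (Metric.closedBall q δ) (Metric.closedBall q' δ) := by
    refine (eventually_all_finite hZ).2 fun q _ => (eventually_all_finite hZ).2 fun q' _ => ?_
    rcases eq_or_ne q q' with hqq | hqq
    · exact Eventually.of_forall fun δ h => (h hqq).elim
    · filter_upwards [nhdsWithin_le_nhds (Iio_mem_nhds (half_pos (dist_pos.2 hqq)))] with δ hδ _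
      exact Metric.closedBall_disjoint_closedBall (by linarith [mem_Iio.1 hδ])
  obtain ⟨δ, ⟨hsub, hdisj⟩, hδ⟩ := ((hsub.and hdisj).and self_mem_nhdsWithin).exists
  exact ⟨δ, hδ, hsub, fun q hq q' hq' => hdisj q hq q' hq'⟩

variable {X : Type*} [NormedAddCommGroup X] [NormedSpace ℝ X] {H : Type*} [TopologicalSpace H]
  {I : ModelWithCorners ℝ X H} {M : Type*} [TopologicalSpace M] [ChartedSpace H M]
  {E F : Type*} [NormedAddCommGroup E] [NormedSpace ℂ E] [NormedAddCommGroup F] [NormedSpace ℂ F]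

theorem contMDiffAt_exteriorCauchy [I.Boundaryless] [IsManifold I ∞ M] {f : M → ℂ → E}
    {G : Set (M × ℂ)} (hG : IsOpen G)
    (hf : ContMDiffOn (I.prod 𝓘(ℝ, ℂ)) 𝓘(ℝ, E) ∞ (fun p : M × ℂ => f p.1 p.2) G) {Z : Finset ℂ}
    {δ : ℝ} (hδ : 0 ≤ δ) {x₀ : M} (hx₀ : ∀ q ∈ Z, ∀ ζ ∈ Metric.sphere q δ, (x₀, ζ) ∈ G) {σ₀ : ℂ}
    (hσ₀ : ∀ q ∈ Z, σ₀ ∉ Metric.sphere q δ) :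
    ContMDiffAt (I.prod 𝓘(ℝ, ℂ)) 𝓘(ℝ, E) ∞
      (fun p : M × ℂ => exteriorCauchy Z δ (f p.1) p.2) (x₀, σ₀) := by
  refine ContMDiffAt.sum fun q hq => contMDiffAt_complex_smul contMDiffAt_const ?_
  let pr : (M × ℂ) × ℂ → M × ℂ := fun x => (x.1.1, x.2)
  have hpr : ContMDiff ((I.prod 𝓘(ℝ, ℂ)).prod 𝓘(ℝ, ℂ)) (I.prod 𝓘(ℝ, ℂ)) ∞ pr :=
    (contMDiff_fst.comp contMDiff_fst).prodMk contMDiff_snd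
  have hsub : ContMDiff ((I.prod 𝓘(ℝ, ℂ)).prod 𝓘(ℝ, ℂ)) 𝓘(ℝ, ℂ) ∞
      (fun x : (M × ℂ) × ℂ => x.1.2 - x.2) :=
    (contMDiff_snd.comp contMDiff_fst).sub contMDiff_snd
  have hG' : IsOpen (pr ⁻¹' G ∩ {x | x.1.2 - x.2 ≠ 0}) :=
    (hG.preimage hpr.continuous).inter (isOpen_ne.preimage hsub.continuous)
  refine contMDiffAt_circleIntegral (n := ⊤) (x₀ := (x₀, σ₀)) hG' (f := fun x : (M × ℂ) × ℂ =>
    (x.1.2 - x.2)⁻¹ • f x.1.1 x.2) (fun x hx => ContMDiffAt.contMDiffWithinAt ?_) hδ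
    fun ζ hζ => ⟨hx₀ q hq ζ hζ, sub_ne_zero.2 fun h : σ₀ = ζ => hσ₀ q hq (h ▸ hζ)⟩
  exact contMDiffAt_complex_smul
    ((contDiffAt_inv ℝ hx.2).comp_contMDiffAt (f := fun x : (M × ℂ) × ℂ => x.1.2 - x.2)
      hsub.contMDiffAt)
    ((hf.contMDiffAt (hG.mem_nhds hx.1)).comp x hpr.contMDiffAt)

variable [CompleteSpace E]

theorem contMDiffOn_inverse_apply [CompleteSpace F] {O : Set M} {W : Set ℂ} (hW : IsOpen W)
    {A : M → ℂ → E →L[ℂ] F} (hA : ContMDiffOn (I.prod 𝓘(ℝ, ℂ)) 𝓘(ℝ, E →L[ℂ] F) ∞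
      (fun p : M × ℂ => A p.1 p.2) (O ×ˢ W)) (hO : IsOpen O) {h : ℂ → F}
    (hh : DifferentiableOn ℂ h W) :
    ContMDiffOn (I.prod 𝓘(ℝ, ℂ)) 𝓘(ℝ, E) ∞ (fun p : M × ℂ => (A p.1 p.2).inverse (h p.2))
      ((O ×ˢ W) ∩ {p | (A p.1 p.2).IsInvertible}) := by
  rintro ⟨x, w⟩ ⟨hxw, hi⟩
  have hhw : ContDiffAt ℝ ∞ h w := (hh.analyticAt (hW.mem_nhds hxw.2)).contDiffAt.restrict_scalars ℝ
  exact (contMDiffAt_complex_clm_apply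
    (contMDiffAt_clm_inverse (hA.contMDiffAt ((hO.prod hW).mem_nhds hxw)) hi)
    (hhw.comp_contMDiffAt (f := Prod.snd) contMDiffAt_snd)).contMDiffWithinAt

/-- Off the singular points, `u + s y = (A y)⁻¹ h`, whose singular part `s y` is given by Cauchy's
formula on small circles around the singular points of `A y₁`. -/
theorem contMDiffAt_singularPart [CompleteSpace F] [I.Boundaryless] [IsManifold I ∞ M]
    {O : Set M} (hO : IsOpen O) {S W : Set ℂ} (hW : IsOpen W) (hWS : W ⊆ S) {A : M → ℂ → E →L[ℂ] F}
    (hA : ContMDiffOn (I.prod 𝓘(ℝ, ℂ)) 𝓘(ℝ, E →L[ℂ] F) ∞ (fun p : M × ℂ => A p.1 p.2) (O ×ˢ W))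
    {y₁ : M} (hy₁ : y₁ ∈ O) (hfin : (singPts S (A y₁)).Finite) (hy₁W : singPts S (A y₁) ⊆ W)
    (husc : UpperHemicontinuousAt (fun y => singPts S (A y)) y₁) {h : ℂ → F}
    (hh : DifferentiableOn ℂ h W) {s : M → ℂ → E}
    (hs : ∀ᶠ y in 𝓝 y₁, s y ∈ polarSums (singPts S (A y)) E ∧ ∃ u : ℂ → E,
      DifferentiableOn ℂ u W ∧ EqOn h (fun w => A y w (u w + s y w)) (W \ singPts S (A y)))
    {σ₁ : ℂ} (hσ₁ : σ₁ ∉ singPts S (A y₁)) :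
    ContMDiffAt (I.prod 𝓘(ℝ, ℂ)) 𝓘(ℝ, E) ∞ (fun p : M × ℂ => s p.1 p.2) (y₁, σ₁) := by
  obtain ⟨δ, hδ, hball, hdisj⟩ := exists_isolating_radius hfin (hW.sdiff isClosed_singleton)
    (fun q hq => (⟨hy₁W hq, fun h => hσ₁ (h ▸ hq)⟩ : q ∈ W \ {σ₁}))
  obtain ⟨Z, hZ⟩ := hfin.exists_finset_coe
  rw [← hZ] at hball hdisj
  have hsing : ∀ᶠ y in 𝓝 y₁, singPts S (A y) ⊆ ⋃ q ∈ Z, Metric.ball q δ :=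
    husc.forall_isOpen _ (isOpen_biUnion fun q _ => Metric.isOpen_ball) fun q hq =>
      mem_iUnion₂.2 ⟨q, hZ.symm.subset hq, Metric.mem_ball_self hδ⟩
  have hσ : ∀ᶠ σ in 𝓝 σ₁, ∀ q ∈ Z, σ ∉ Metric.closedBall q δ :=
    (eventually_all_finset Z).2 fun q hq =>
      Metric.isClosed_closedBall.isOpen_compl.mem_nhds fun h => (hball q hq h).2 rfl
  have hsphere {y : M} (hy : singPts S (A y) ⊆ ⋃ q ∈ Z, Metric.ball q δ) {q : ℂ} (hq : q ∈ Z)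
      {ζ : ℂ} (hζ : ζ ∈ Metric.sphere q δ) : ζ ∈ W \ singPts S (A y) :=
    ⟨(hball q hq (Metric.sphere_subset_closedBall hζ)).1,
      fun h => notMem_iUnion_ball_of_mem_sphere hdisj hq hζ (hy h)⟩
  have hCauchy : ∀ᶠ p : M × ℂ in 𝓝 (y₁, σ₁),
      s p.1 p.2 = exteriorCauchy Z δ (fun ζ => (A p.1 ζ).inverse (h ζ)) p.2 := by
    rw [nhds_prod_eq]
    filter_upwards [(hsing.and hs).prod_mk hσ] with p ⟨⟨hpZ, hps, u, hu, hhu⟩, hpσ⟩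
    rw [← exteriorCauchy_add_of_mem_polarSums hδ.le hdisj (fun q hq z hz =>
      hu.differentiableAt (hW.mem_nhds (hball q hq hz).1)) (polarSums_mono hpZ hps) hpσ]
    refine exteriorCauchy_congr hδ.le (fun q hq ζ hζ => ?_) _
    obtain ⟨hζW, hζs⟩ := hsphere hpZ hq hζ
    change u ζ + s p.1 ζ = (A p.1 ζ).inverse (h ζ)
    rw [hhu ⟨hζW, hζs⟩]
    exact ((isInvertible_of_notMem_singPts (hWS hζW) hζs).inverse_apply_self _).symm
  have hopen : IsOpen ((O ×ˢ W) ∩ {p | (A p.1 p.2).IsInvertible}) :=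
    hA.continuousOn.isOpen_inter_preimage (hO.prod hW) ContinuousLinearEquiv.isOpen
  have hmem : ∀ q ∈ Z, ∀ ζ ∈ Metric.sphere q δ,
      (y₁, ζ) ∈ (O ×ˢ W) ∩ {p | (A p.1 p.2).IsInvertible} := fun q hq ζ hζ =>
    have ⟨hζW, hζs⟩ := hsphere hsing.self_of_nhds hq hζ
    ⟨⟨hy₁, hζW⟩, isInvertible_of_notMem_singPts (hWS hζW) hζs⟩
  have hsmooth := contMDiffAt_exteriorCauchy (f := fun y ζ => (A y ζ).inverse (h ζ)) hopen
    (contMDiffOn_inverse_apply hW hA hO hh) hδ.le hmem (σ₀ := σ₁)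
    fun q hq hζ => hσ.self_of_nhds q hq (Metric.sphere_subset_closedBall hζ)
  exact hsmooth.congr_of_eventuallyEq hCauchy

theorem IsFredholmOn.linearIndependent_restrict [CompleteSpace F] {S : Set ℂ} (hS : IsOpen S)
    {A : ℂ → E →L[ℂ] F} (hA : IsFredholmOn S A) {O : Set ℂ} (hO : IsOpen O) (hOn : O.Nonempty)
    {ι : Type*} {s : ι → kernelSpace S A} (hs : LinearIndependent ℂ s) :
    LinearIndependent ℂ fun j (σ : O) => (s j).1 (σ : ℂ) := by
  let restrict : kernelSpace S A →ₗ[ℂ] (O → E) :=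
    LinearMap.funLeft ℂ E Subtype.val ∘ₗ (kernelSpace S A).subtype
  refine hs.map' restrict (LinearMap.ker_eq_bot'.2 fun t ht => Subtype.ext ?_)
  exact eq_zero_of_mem_polarSums_of_eqOn_open (hA.mem_polarSums hS t.2) hO hOn
    fun σ hσ => congrFun ht ⟨σ, hσ⟩

variable [CompleteSpace F]

theorem exists_local_stable_basis {O : Set M} (hO : IsOpen O) {S : Set ℂ} (hS : IsOpen S)
    {A : M → ℂ → E →L[ℂ] F} (hA : ContinuousOn (fun p : M × ℂ => A p.1 p.2) (O ×ˢ S))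
    (hF : ∀ y ∈ O, IsFredholmOn S (A y)) {y₀ : M} (hy₀ : y₀ ∈ O)
    (husc : UpperHemicontinuousAt (fun y => singPts S (A y)) y₀) :
    ∃ K ⊆ S, IsCompact K ∧ ∃ (r : ℕ) (h : Fin r → holoSpace K F)
      (s : ∀ y, Fin r → kernelSpace S (A y)), ∀ᶠ y in 𝓝 y₀, singPts S (A y) ⊆ interior K ∧
        (∀ j, ∃ u : holoSpace K E,
          EqOn (h j) (fun w => A y w (u w + (s y j).1 w)) (K \ singPts S (A y))) ∧
        Function.Bijective (Fintype.linearCombination ℂ (s y)) := by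
  classical
  obtain ⟨K, hKc, hK₀, hKS⟩ := exists_compact_between (hF y₀ hy₀).finite.isCompact hS
    fun p hp => hp.1
  obtain ⟨O₁, hO₁, hO₁o, hy₀₁⟩ := eventually_nhds_iff.1
    ((husc.forall_isOpen _ isOpen_interior hK₀).and (hO.eventually_mem hy₀))
  have hcont : ContinuousOn (fun p : O₁ × ℂ => A p.1 p.2) (univ ×ˢ S) :=
    hA.comp (f := fun p : O₁ × ℂ => ((p.1 : M), p.2)) (by fun_prop)
      fun p hp => ⟨(hO₁ p.1 p.1.2).2, hp.2⟩
  obtain ⟨r, h, s₁, hs₁, hbij⟩ := exists_stable_basis (A := fun y : O₁ => A y) hS hKc hKS hcont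
    (fun y => hF y (hO₁ y y.2).2) (fun y => (hO₁ y y.2).1) ⟨y₀, hy₀₁⟩
  let s : ∀ y, Fin r → kernelSpace S (A y) := fun y => if hy : y ∈ O₁ then s₁ ⟨y, hy⟩ else 0
  have hs (y : O₁) : s y = s₁ y := dif_pos y.2
  refine ⟨K, hKS, hKc, r, h, s, ?_⟩
  rw [← hO₁o.isOpenEmbedding_subtypeVal.map_nhds_eq ⟨y₀, hy₀₁⟩, eventually_map]
  filter_upwards [hbij] with y hy
  rw [hs]
  exact ⟨(hO₁ y y.2).1, hs₁ y, hy⟩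

variable (I) in
/-- The elements `s y` of the kernel spaces of a family of operators form a smooth frame at `y`:
they are a basis over `y`, they depend smoothly on the parameter off the singular set, and so do the
coefficients of their combinations that depend smoothly on the parameter there. -/
structure IsSmoothFrameAt (S : Set ℂ) (A : M → ℂ → E →L[ℂ] F) {r : ℕ}
    (s : ∀ y, Fin r → kernelSpace S (A y)) (y : M) : Prop where
  bijective : Function.Bijective (Fintype.linearCombination ℂ (s y))
  smooth : ∀ σ, σ ∉ singPts S (A y) → ∀ j,
    ContMDiffAt (I.prod 𝓘(ℝ, ℂ)) 𝓘(ℝ, E) ∞ (fun p : M × ℂ => (s p.1 j).1 p.2) (y, σ)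
  coeff_smooth : ∀ c : M → Fin r → ℂ,
    (∀ σ, σ ∉ singPts S (A y) →
      ContMDiffAt I 𝓘(ℝ, E) ∞ (fun y => ∑ j, c y j • (s y j).1 σ) y) →
    ContMDiffAt I 𝓘(ℝ, Fin r → ℂ) ∞ c y

theorem exists_isSmoothFrameAt [I.Boundaryless] [IsManifold I ∞ M] {O : Set M} (hO : IsOpen O)
    {S : Set ℂ} (hS : IsOpen S) {A : M → ℂ → E →L[ℂ] F}
    (hA : ContMDiffOn (I.prod 𝓘(ℝ, ℂ)) 𝓘(ℝ, E →L[ℂ] F) ∞ (fun p : M × ℂ => A p.1 p.2) (O ×ˢ S))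
    (hF : ∀ y ∈ O, IsFredholmOn S (A y))
    (husc : ∀ y ∈ O, UpperHemicontinuousAt (fun y => singPts S (A y)) y) {y₀ : M} (hy₀ : y₀ ∈ O) :
    ∃ (r : ℕ) (s : ∀ y, Fin r → kernelSpace S (A y)), ∀ᶠ y in 𝓝 y₀,
      IsSmoothFrameAt I S A s y := by
  obtain ⟨K, hKS, hKc, r, h, s, hs⟩ := exists_local_stable_basis hO hS hA.continuousOn hF hy₀
    (husc y₀ hy₀)
  have hsmooth : ∀ᶠ y in 𝓝 y₀, ∀ σ, σ ∉ singPts S (A y) → ∀ j,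
      ContMDiffAt (I.prod 𝓘(ℝ, ℂ)) 𝓘(ℝ, E) ∞ (fun p : M × ℂ => (s p.1 j).1 p.2) (y, σ) := by
    filter_upwards [hs.eventually_nhds, hO.eventually_mem hy₀] with y hsy hyO σ hσ j
    refine contMDiffAt_singularPart (h := h j) (s := fun y => (s y j).1) hO isOpen_interior
      (interior_subset.trans hKS) (hA.mono (prod_mono_right (interior_subset.trans hKS)))
      hyO (hF y hyO).finite hsy.self_of_nhds.1 (husc y hyO)
      (fun w hw => (holoSpace_differentiableAt (h j) hw).differentiableWithinAt) ?_ hσ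
    filter_upwards [hsy, hO.eventually_mem hyO] with y' ⟨_, hu, _⟩ hyO'
    obtain ⟨u, hu⟩ := hu j
    exact ⟨(hF y' hyO').mem_polarSums hS (s y' j).2, u,
      fun w hw => (holoSpace_differentiableAt u hw).differentiableWithinAt,
      hu.mono (sdiff_subset_sdiff_left interior_subset)⟩
  have hregular : ∀ᶠ y in 𝓝 y₀, ∀ σ ∈ Kᶜ, σ ∉ singPts S (A y) :=
    hs.mono fun y hy σ hσ hσs => hσ (interior_subset (hy.1 hσs))
  have hli := (hF y₀ hy₀).linearIndependent_restrict hS hKc.isClosed.isOpen_compl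
    (nonempty_compl.2 fun hK => noncompact_univ ℂ (hK ▸ hKc))
    (linearIndependent_iff_injective_fintypeLinearCombination.2 hs.self_of_nhds.2.2.1)
  have hcoef := eventually_contMDiffAt_coefficients (I := I)
    (f := fun y j (σ : (Kᶜ : Set ℂ)) => (s y j).1 (σ : ℂ))
    ((hsmooth.and hregular).mono fun y ⟨hy, hyK⟩ j σ =>
      (hy σ (hyK σ σ.2) j).comp y (contMDiffAt_id.prodMk contMDiffAt_const)) hli
  refine ⟨r, s, ?_⟩
  filter_upwards [hs, hsmooth, hcoef, hregular] with y ⟨_, _, hyb⟩ hys hyc hyK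
  exact ⟨hyb, hys, fun c hc => hyc c fun σ => hc σ (hyK σ σ.2)⟩

end LocalFrame

/-! ### Change of coordinates -/

section Transport

variable {E E' F F' : Type*} [NormedAddCommGroup E] [NormedSpace ℂ E]
  [NormedAddCommGroup E'] [NormedSpace ℂ E'] [NormedAddCommGroup F] [NormedSpace ℂ F]
  [NormedAddCommGroup F'] [NormedSpace ℂ F'] {S : Set ℂ}

/-- The family `R A(σ) T⁻¹`, i.e. `A` in the coordinates given by the isomorphisms `T` and `R`. -/
def conjFamily (T : E ≃L[ℂ] E') (R : F ≃L[ℂ] F') (A : ℂ → E →L[ℂ] F) (σ : ℂ) : E' →L[ℂ] F' :=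
  (R : F →L[ℂ] F') ∘L A σ ∘L (T.symm : E' →L[ℂ] E)

theorem conjFamily_symm (T : E ≃L[ℂ] E') (R : F ≃L[ℂ] F') (A : ℂ → E →L[ℂ] F) :
    conjFamily T.symm R.symm (conjFamily T R A) = A := by
  ext σ v
  simp [conjFamily]

theorem singPts_conjFamily (T : E ≃L[ℂ] E') (R : F ≃L[ℂ] F') (A : ℂ → E →L[ℂ] F) :
    singPts S (conjFamily T R A) = singPts S A := by
  ext σ
  simp [singPts, conjFamily]

theorem IsFredholmOn.conjFamily (T : E ≃L[ℂ] E') (R : F ≃L[ℂ] F') {A : ℂ → E →L[ℂ] F}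
    (hA : IsFredholmOn S A) : IsFredholmOn S (conjFamily T R A) where
  differentiableOn :=
    (differentiableOn_const _).clm_comp (hA.differentiableOn.clm_comp (differentiableOn_const _))
  correction p hp := by
    obtain ⟨N, C, B, h⟩ := hA.correction p hp
    refine ⟨N, C ∘L (T.symm : E' →L[ℂ] E), (R : F →L[ℂ] F') ∘L B, ?_⟩
    have hconj : KernelBundle.conjFamily T R A p + ((R : F →L[ℂ] F') ∘L B) ∘L C ∘L
        (T.symm : E' →L[ℂ] E) = (R : F →L[ℂ] F') ∘L (A p + B ∘L C) ∘L (T.symm : E' →L[ℂ] E) := by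
      ext v
      simp [KernelBundle.conjFamily]
    rwa [hconj, ContinuousLinearMap.isInvertible_equiv_comp,
      ContinuousLinearMap.isInvertible_comp_equiv]
  finite := by rw [singPts_conjFamily]; exact hA.finite

theorem comp_mem_polarSums (L : E →L[ℂ] E') {V : Set ℂ} {s : ℂ → E} (hs : s ∈ polarSums V E) :
    L ∘ s ∈ polarSums V E' := by
  suffices h : polarSums V E ≤ (polarSums V E').comap ((L : E →ₗ[ℂ] E').compLeft ℂ) from h hs
  refine Submodule.span_le.2 ?_
  rintro _ ⟨p, hp, k, a, rfl⟩
  have h := inv_pow_smul_mem_polarSums hp k (L a)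
  simp_rw [← map_smul] at h
  exact h

theorem comp_mem_kernelSpace (T : E ≃L[ℂ] E') (R : F ≃L[ℂ] F') {A : ℂ → E →L[ℂ] F} {s : ℂ → E}
    (hs : s ∈ kernelSpace S A) : T ∘ s ∈ kernelSpace S (conjFamily T R A) := by
  obtain ⟨φ, hφ, hAφ, hs, hφs⟩ := hs
  refine ⟨T ∘ φ, fun p hp => ?_, fun p hp => ?_, comp_mem_polarSums (T : E →L[ℂ] E') hs,
    fun p hp => ?_⟩
  · obtain ⟨m, hm⟩ := hφ p hp
    exact ⟨m, by
      simpa using analyticAt_clm_apply (A := fun _ => (T : E →L[ℂ] E')) analyticAt_const hm⟩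
  · simpa [conjFamily] using (hAφ p hp).const_clm_apply (R : F →L[ℂ] F')
  · simpa [Pi.sub_def] using (hφs p hp).const_clm_apply (T : E →L[ℂ] E')

/-- The isomorphism of the spaces of singular parts that belongs to a change of coordinates. -/
def kernelSpaceConj (T : E ≃L[ℂ] E') (R : F ≃L[ℂ] F') (A : ℂ → E →L[ℂ] F) :
    kernelSpace S (conjFamily T R A) ≃ₗ[ℂ] kernelSpace S A where
  toFun s := ⟨T.symm ∘ s.1, by
    simpa only [conjFamily_symm] using comp_mem_kernelSpace T.symm R.symm s.2⟩
  invFun s := ⟨T ∘ s.1, comp_mem_kernelSpace T R s.2⟩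
  map_add' _ _ := Subtype.ext (funext fun _ => map_add T.symm _ _)
  map_smul' c _ := Subtype.ext (funext fun _ => map_smul T.symm c _)
  left_inv _ := Subtype.ext (funext fun _ => T.apply_symm_apply _)
  right_inv _ := Subtype.ext (funext fun _ => T.symm_apply_apply _)

end Transport

/-! ### Local frames of the kernel bundle -/

section Frame

variable {Y : Type*} [TopologicalSpace Y] {D H₂ : Y → Type*}
  [∀ y, NormedAddCommGroup (D y)] [∀ y, NormedSpace ℂ (D y)]
  [∀ y, NormedAddCommGroup (H₂ y)] [∀ y, NormedSpace ℂ (H₂ y)]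
  {S : Set ℂ} {P : ∀ y, ℂ → D y →L[ℂ] H₂ y}

theorem upperHemicontinuousAt_singPts (hclosed : IsClosed (singGraph S P)) {y₀ : Y}
    (hbdd : ∃ U ∈ 𝓝 y₀, Bornology.IsBounded (⋃ y ∈ U, singPts S (P y))) :
    UpperHemicontinuousAt (fun y => singPts S (P y)) y₀ := by
  refine .of_forall_isOpen fun V hV h => ?_
  obtain ⟨U, hU, hb⟩ := hbdd
  obtain ⟨R, hR⟩ := hb.subset_closedBall 0
  obtain ⟨u, v, hu, -, hyu, hCv, huv⟩ := generalized_tube_lemma (isCompact_singleton (x := y₀))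
    ((isCompact_closedBall (0 : ℂ) R).diff hV) hclosed.isOpen_compl (by
      rintro ⟨y, σ⟩ ⟨hy, hσ⟩ hs
      obtain rfl : y = y₀ := hy
      exact hσ.2 (h hs))
  filter_upwards [hU, hu.mem_nhds (hyu rfl)] with y hyU hyu σ hσ
  by_contra hσV
  exact (huv (show (y, σ) ∈ u ×ˢ v from
    ⟨hyu, hCv ⟨hR (mem_iUnion₂.2 ⟨y, hyU, hσ⟩), hσV⟩⟩)) hσ

variable {X : Type*} [NormedAddCommGroup X] [NormedSpace ℝ X] {H : Type*} [TopologicalSpace H]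
  {I : ModelWithCorners ℝ X H} [ChartedSpace H Y]
  {FD F₂ : Type*} [NormedAddCommGroup FD] [NormedSpace ℂ FD]
  [NormedAddCommGroup F₂] [NormedSpace ℂ F₂]
  [TopologicalSpace (TotalSpace FD D)] [FiberBundle FD D]

variable (I FD) in
/-- `s` is a frame of the kernel bundle near `y`: a basis over `y`, smooth off the singular set,
such that the coefficients of the combinations that are smooth off the singular set are smooth. -/
structure IsKernelFrameAt (S : Set ℂ) (P : ∀ y, ℂ → D y →L[ℂ] H₂ y) {r : ℕ}
    (s : ∀ y, Fin r → KernelFiber S P y) (y : Y) : Prop where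
  bijective : Function.Bijective (Fintype.linearCombination ℂ (s y))
  smooth : ∀ σ, σ ∉ singPts S (P y) → ∀ j,
    ContMDiffAt (I.prod 𝓘(ℝ, ℂ)) (I.prod 𝓘(ℝ, FD)) ∞
      (fun p : Y × ℂ => TotalSpace.mk' FD p.1 ((s p.1 j).toFun p.2)) (y, σ)
  coeff_smooth : ∀ c : Y → Fin r → ℂ,
    (∀ σ, σ ∉ singPts S (P y) → ContMDiffAt I (I.prod 𝓘(ℝ, FD)) ∞
      (fun y => TotalSpace.mk' FD y (∑ j, c y j • (s y j).toFun σ)) y) →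
    ContMDiffAt I 𝓘(ℝ, Fin r → ℂ) ∞ c y

variable [VectorBundle ℂ FD D] [TopologicalSpace (TotalSpace F₂ H₂)] [FiberBundle F₂ H₂]
  [VectorBundle ℂ F₂ H₂] (e : Trivialization FD (π FD D)) [MemTrivializationAtlas e]
  (e₂ : Trivialization F₂ (π F₂ H₂)) [MemTrivializationAtlas e₂]

/-- The family `P` in trivializations. -/
def localFamily (P : ∀ y, ℂ → D y →L[ℂ] H₂ y) (y : Y) (σ : ℂ) : FD →L[ℂ] F₂ :=
  e₂.continuousLinearMapAt ℂ y ∘L P y σ ∘L e.symmL ℂ y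

theorem localFamily_eq_conjFamily {y : Y} (hy : y ∈ e.baseSet ∩ e₂.baseSet) :
    localFamily e e₂ P y = conjFamily (e.continuousLinearEquivAt ℂ y hy.1)
      (e₂.continuousLinearEquivAt ℂ y hy.2) (P y) := by
  funext σ
  rw [conjFamily, e₂.coe_continuousLinearEquivAt_eq' hy.2, e.symm_continuousLinearEquivAt_eq' hy.1,
    localFamily]

theorem singPts_localFamily {y : Y} (hy : y ∈ e.baseSet ∩ e₂.baseSet) :
    singPts S (localFamily e e₂ P y) = singPts S (P y) := by
  rw [localFamily_eq_conjFamily e e₂ hy, singPts_conjFamily]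

/-- The isomorphism of a fiber of the kernel bundle with the kernel space of the family in
trivializations. -/
def localKernelEquiv {y : Y} (hy : y ∈ e.baseSet ∩ e₂.baseSet) :
    kernelSpace S (localFamily e e₂ P y) ≃ₗ[ℂ] KernelFiber S P y :=
  (LinearEquiv.ofEq _ _ (by rw [localFamily_eq_conjFamily e e₂ hy])).trans
    (kernelSpaceConj (e.continuousLinearEquivAt ℂ y hy.1) (e₂.continuousLinearEquivAt ℂ y hy.2)
      (P y))

theorem localKernelEquiv_toFun {y : Y} (hy : y ∈ e.baseSet ∩ e₂.baseSet)
    (s : kernelSpace S (localFamily e e₂ P y)) (σ : ℂ) :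
    (localKernelEquiv e e₂ hy s).toFun σ = e.symm y (s.1 σ) :=
  rfl

theorem IsSmoothFrameAt.isKernelFrameAt [ContMDiffVectorBundle ∞ FD D I] {r : ℕ}
    {s₀ : ∀ y, Fin r → kernelSpace S (localFamily e e₂ P y)} {s : ∀ y, Fin r → KernelFiber S P y}
    (hs : ∀ y (hy : y ∈ e.baseSet ∩ e₂.baseSet) j, s y j = localKernelEquiv e e₂ hy (s₀ y j))
    {y : Y} (hy : y ∈ e.baseSet ∩ e₂.baseSet)
    (h : IsSmoothFrameAt I S (localFamily e e₂ P) s₀ y) : IsKernelFrameAt I FD S P s y := by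
  have hnhds : ∀ᶠ y' in 𝓝 y, y' ∈ e.baseSet ∩ e₂.baseSet :=
    (e.open_baseSet.inter e₂.open_baseSet).eventually_mem hy
  have hcoord : ∀ y' ∈ e.baseSet ∩ e₂.baseSet, ∀ j σ,
      (e ⟨y', (s y' j).toFun σ⟩).2 = (s₀ y' j).1 σ := fun y' hy' j σ => by
    rw [hs y' hy', localKernelEquiv_toFun, e.apply_mk_symm hy'.1]
  have hcomb : ∀ y' ∈ e.baseSet ∩ e₂.baseSet, ∀ (c : Fin r → ℂ) σ,
      (e ⟨y', ∑ j, c j • (s y' j).toFun σ⟩).2 = ∑ j, c j • (s₀ y' j).1 σ := fun y' hy' c σ => by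
    have hlin : ∀ v, (e ⟨y', v⟩).2 = e.linearEquivAt ℂ y' hy'.1 v := fun v => rfl
    simp only [hlin, map_sum, map_smul, ← hcoord y' hy']
  refine ⟨?_, fun σ hσ j => ?_, fun c hc => h.coeff_smooth c fun σ hσ => ?_⟩
  · have hequiv : Fintype.linearCombination ℂ (s y) =
        (localKernelEquiv e e₂ hy).toLinearMap ∘ₗ Fintype.linearCombination ℂ (s₀ y) :=
      LinearMap.ext fun c => by
        simp only [Fintype.linearCombination_apply, hs y hy, LinearMap.comp_apply, map_sum,
          map_smul, LinearEquiv.coe_coe]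
    rw [hequiv]
    exact (localKernelEquiv e e₂ hy).bijective.comp h.bijective
  · rw [← singPts_localFamily e e₂ hy] at hσ
    refine (e.contMDiffAt_iff (e.mem_source.2 hy.1)).2
      ⟨contMDiffAt_fst, (h.smooth σ hσ j).congr_of_eventuallyEq ?_⟩
    filter_upwards [continuous_fst.continuousAt.eventually hnhds] with p hp
      using hcoord p.1 hp j p.2
  · rw [singPts_localFamily e e₂ hy] at hσ
    refine ((e.contMDiffAt_iff (e.mem_source.2 hy.1)).1 (hc σ hσ)).2.congr_of_eventuallyEq ?_
    filter_upwards [hnhds] with y' hy' using (hcomb y' hy' (c y') σ).symm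

theorem exists_isKernelFrameAt [I.Boundaryless] [IsManifold I ∞ Y] [ContMDiffVectorBundle ∞ FD D I]
    [CompleteSpace FD] [CompleteSpace F₂] (hS : IsOpen S)
    (hsmooth : ContMDiffOn (I.prod 𝓘(ℝ, ℂ)) 𝓘(ℝ, FD →L[ℂ] F₂) ∞
      (fun p : Y × ℂ => localFamily e e₂ P p.1 p.2) ((e.baseSet ∩ e₂.baseSet) ×ˢ S))
    (hP : ∀ y, IsFredholmOn S (P y))
    (husc : ∀ y, UpperHemicontinuousAt (fun y => singPts S (P y)) y)
    {y₀ : Y} (hy₀ : y₀ ∈ e.baseSet ∩ e₂.baseSet) :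
    ∃ (r : ℕ) (s : ∀ y, Fin r → KernelFiber S P y), ∀ᶠ y in 𝓝 y₀, IsKernelFrameAt I FD S P s y := by
  classical
  have hO : IsOpen (e.baseSet ∩ e₂.baseSet) := e.open_baseSet.inter e₂.open_baseSet
  obtain ⟨r, s₀, hs₀⟩ := exists_isSmoothFrameAt hO hS hsmooth
    (fun y hy => by
      rw [localFamily_eq_conjFamily e e₂ hy]
      exact (hP y).conjFamily _ _)
    (fun y hy => .of_forall_isOpen fun V hV hyV => by
      rw [singPts_localFamily e e₂ hy] at hyV
      filter_upwards [(husc y).forall_isOpen V hV hyV, hO.eventually_mem hy] with y' hy'V hy'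
      rwa [singPts_localFamily e e₂ hy']) hy₀
  refine ⟨r, fun y j => if hy : y ∈ e.baseSet ∩ e₂.baseSet then
    localKernelEquiv e e₂ hy (s₀ y j) else 0, ?_⟩
  filter_upwards [hs₀, hO.eventually_mem hy₀] with y hy hyO
  exact hy.isKernelFrameAt e e₂ (fun y hy j => dif_pos hy) hyO

end Frame

/-! ### Smooth vector bundles from local frames -/

section Construction

variable {X : Type*} [NormedAddCommGroup X] [NormedSpace ℝ X] {H : Type*} [TopologicalSpace H]
  {I : ModelWithCorners ℝ X H} {Y : Type*} [TopologicalSpace Y]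
  {F : Type*} [NormedAddCommGroup F] [NormedSpace ℂ F]
  {E : Y → Type*} [∀ y, AddCommGroup (E y)] [∀ y, Module ℂ (E y)]

/-- The pretrivialization over `U` whose fiberwise inverses are given linear bijections. -/
def frameTrivialization {U : Set Y} (hU : IsOpen U) (φ : ∀ y, F →ₗ[ℂ] E y)
    (hφ : ∀ y ∈ U, Function.Bijective (φ y)) : Pretrivialization F (π F E) where
  toFun p := (p.proj, Function.invFun (φ p.proj) p.2)
  invFun q := ⟨q.1, φ q.1 q.2⟩
  source := π F E ⁻¹' U
  target := U ×ˢ univ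
  map_source' _ hp := ⟨hp, mem_univ _⟩
  map_target' _ hq := hq.1
  left_inv' := by
    rintro ⟨y, x⟩ hy
    exact congrArg (TotalSpace.mk' F y) (Function.rightInverse_invFun (hφ y hy).2 x)
  right_inv' := by
    rintro ⟨y, v⟩ ⟨hy, -⟩
    exact congrArg (Prod.mk y) (Function.leftInverse_invFun (hφ y hy).1 v)
  open_target := hU.prod isOpen_univ
  baseSet := U
  open_baseSet := hU
  source_eq := rfl
  target_eq := rfl
  proj_toFun _ _ := rfl

section

variable {U : Set Y} (hU : IsOpen U) (φ : ∀ y, F →ₗ[ℂ] E y)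
  (hφ : ∀ y ∈ U, Function.Bijective (φ y))

theorem frameTrivialization_apply {y : Y} (hy : y ∈ U) {x : E y} {v : F} (h : φ y v = x) :
    (frameTrivialization hU φ hφ ⟨y, x⟩).2 = v := by
  rw [← h]
  exact Function.leftInverse_invFun (hφ y hy).1 v

theorem frameTrivialization_symm {y : Y} (hy : y ∈ U) (v : F) :
    (frameTrivialization hU φ hφ).symm y v = φ y v :=
  TotalSpace.mk_inj.1 ((frameTrivialization hU φ hφ).mk_symm hy v)

theorem isLinear_frameTrivialization : (frameTrivialization hU φ hφ).IsLinear ℂ := by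
  refine ⟨fun y hy => ⟨fun x x' => ?_, fun c x => ?_⟩⟩
  · obtain ⟨v, rfl⟩ := (hφ y hy).2 x
    obtain ⟨v', rfl⟩ := (hφ y hy).2 x'
    rw [frameTrivialization_apply hU φ hφ hy (map_add (φ y) v v'),
      frameTrivialization_apply hU φ hφ hy rfl, frameTrivialization_apply hU φ hφ hy rfl]
  · obtain ⟨v, rfl⟩ := (hφ y hy).2 x
    rw [frameTrivialization_apply hU φ hφ hy (map_smul (φ y) c v),
      frameTrivialization_apply hU φ hφ hy rfl]

end

variable [ChartedSpace H Y]

variable (I F E) in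
/-- A smooth vector bundle atlas on a family of bare vector spaces `E y`: linear bijections
`frame i y : F → E y` over open neighborhoods `U i` of the points `i` of the base, together with
smooth families `coordChange i k` of operators that change the coordinates from the `i`-th to the
`k`-th frame. -/
structure SmoothFrameAtlas where
  U : Y → Set Y
  isOpen_U : ∀ i, IsOpen (U i)
  mem_U : ∀ i, i ∈ U i
  frame : Y → ∀ y, F →ₗ[ℂ] E y
  bijective_frame : ∀ i, ∀ y ∈ U i, Function.Bijective (frame i y)
  coordChange : Y → Y → Y → F →L[ℂ] F
  contMDiffOn_coordChange : ∀ i k,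
    ContMDiffOn I 𝓘(ℝ, F →L[ℂ] F) ∞ (coordChange i k) (U i ∩ U k)
  frame_coordChange : ∀ i k, ∀ y ∈ U i ∩ U k, ∀ v,
    frame k y (coordChange i k y v) = frame i y v

namespace SmoothFrameAtlas

variable (a : SmoothFrameAtlas I F E)

/-- The trivialization given by the `i`-th frame. -/
def trivialization (i : Y) : Pretrivialization F (π F E) :=
  frameTrivialization (a.isOpen_U i) (a.frame i) (a.bijective_frame i)

theorem coordChange_apply {i k y : Y} (hy : y ∈ a.U i ∩ a.U k) (v : F) :
    a.coordChange i k y v = (a.trivialization k ⟨y, (a.trivialization i).symm y v⟩).2 := by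
  rw [trivialization, trivialization, frameTrivialization_symm _ _ _ hy.1]
  exact (frameTrivialization_apply _ _ _ hy.2 (a.frame_coordChange i k y hy v)).symm

/-- The vector prebundle of the atlas, for a topology on the fibers in which the coordinates
over each point are homeomorphisms. -/
def prebundle [∀ y, TopologicalSpace (E y)]
    (hE : ∀ y, IsInducing (Function.invFun (a.frame y y))) : VectorPrebundle ℂ F E where
  pretrivializationAtlas := range a.trivialization
  pretrivialization_linear' := by
    rintro _ ⟨i, rfl⟩
    exact isLinear_frameTrivialization _ _ _
  pretrivializationAt := a.trivialization
  mem_base_pretrivializationAt := a.mem_U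
  pretrivialization_mem_atlas := mem_range_self
  exists_coordChange := by
    rintro _ ⟨i, rfl⟩ _ ⟨k, rfl⟩
    exact ⟨a.coordChange i k, (a.contMDiffOn_coordChange i k).continuousOn,
      fun _ hy => a.coordChange_apply hy⟩
  totalSpaceMk_isInducing y := (isEmbedding_prodMkRight y).isInducing.comp (hE y)

theorem exists_contMDiffVectorBundle :
    ∃ (_ : TopologicalSpace (TotalSpace F E)) (_ : ∀ y, TopologicalSpace (E y))
      (_ : FiberBundle F E) (_ : VectorBundle ℂ F E),
      ContMDiffVectorBundle ∞ F E I ∧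
      ∀ (s : ∀ y, E y) (y₀ : Y) (c : Y → F), (∀ y ∈ a.U y₀, a.frame y₀ y (c y) = s y) →
        (ContMDiffAt I (I.prod 𝓘(ℝ, F)) ∞ (fun y => TotalSpace.mk' F y (s y)) y₀ ↔
          ContMDiffAt I 𝓘(ℝ, F) ∞ c y₀) := by
  let _ : ∀ y, TopologicalSpace (E y) := fun y =>
    TopologicalSpace.induced (Function.invFun (a.frame y y)) inferInstance
  let b : VectorPrebundle ℂ F E := a.prebundle fun y => ⟨rfl⟩
  let _ : TopologicalSpace (TotalSpace F E) := b.totalSpaceTopology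
  let _ : FiberBundle F E := b.toFiberBundle
  have : VectorBundle ℂ F E := b.toVectorBundle
  have hsmooth : ContMDiffVectorBundle ∞ F E I := by
    refine ⟨?_⟩
    intro t t' ht ht'
    obtain ⟨_, ⟨i, rfl⟩, rfl⟩ := id ht.out
    obtain ⟨_, ⟨k, rfl⟩, rfl⟩ := id ht'.out
    have hreal : ContDiff ℝ ∞ (fun T : F →L[ℂ] F => T.restrictScalars ℝ) :=
      (ContinuousLinearMap.restrictScalarsL ℂ F F ℝ ℝ).contDiff
    refine (hreal.contMDiff.comp_contMDiffOn (a.contMDiffOn_coordChange i k)).congr fun y hy => ?_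
    ext v
    exact (Trivialization.coordChangeL_apply _ _ hy v).trans (a.coordChange_apply hy v).symm
  refine ⟨inferInstance, inferInstance, inferInstance, inferInstance, hsmooth,
    fun s y₀ c hc => ?_⟩
  rw [contMDiffAt_section]
  refine Filter.EventuallyEq.contMDiffAt_iff ?_
  filter_upwards [(a.isOpen_U y₀).mem_nhds (a.mem_U y₀)] with y hy
  exact frameTrivialization_apply (a.isOpen_U y₀) (a.frame y₀) (a.bijective_frame y₀) hy (hc y hy)

end SmoothFrameAtlas

end Construction

/-! ### Smooth sections of the kernel bundle -/

section Sections

variable {Y : Type*} {D H₂ : Y → Type*}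
  [∀ y, NormedAddCommGroup (D y)] [∀ y, NormedSpace ℂ (D y)]
  [∀ y, NormedAddCommGroup (H₂ y)] [∀ y, NormedSpace ℂ (H₂ y)]
  {S : Set ℂ} {P : ∀ y, ℂ → D y →L[ℂ] H₂ y} {r : ℕ}

theorem KernelFiber.toFun_linearCombination {y : Y} (s : Fin r → KernelFiber S P y)
    (c : Fin r → ℂ) (σ : ℂ) :
    (Fintype.linearCombination ℂ s c).toFun σ = ∑ j, c j • (s j).toFun σ := by
  let ev : KernelFiber S P y →ₗ[ℂ] D y := LinearMap.proj σ ∘ₗ (kernelSpace S (P y)).subtype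
  rw [Fintype.linearCombination_apply]
  refine (map_sum ev _ _).trans (Finset.sum_congr rfl fun j _ => ?_)
  exact map_smul ev _ _

/-- The linear map from coordinate vectors to the fiber over `y` that belongs to a frame. -/
def frameMap (s : ∀ y, Fin r → KernelFiber S P y) (y : Y) :
    EuclideanSpace ℂ (Fin r) →ₗ[ℂ] KernelFiber S P y :=
  Fintype.linearCombination ℂ (s y) ∘ₗ (EuclideanSpace.equiv (Fin r) ℂ).toLinearEquiv.toLinearMap

/-- The coefficients of a section with respect to a frame. -/
def frameCoeff (s : ∀ y, Fin r → KernelFiber S P y) (t : ∀ y, KernelFiber S P y) (y : Y) :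
    Fin r → ℂ :=
  Function.invFun (Fintype.linearCombination ℂ (s y)) (t y)

/-- The operator that changes the coordinates with respect to the frame `s` to those with respect to
the frame `t`. -/
def frameChange (s t : ∀ y, Fin r → KernelFiber S P y) (y : Y) :
    EuclideanSpace ℂ (Fin r) →L[ℂ] EuclideanSpace ℂ (Fin r) :=
  ∑ j, (EuclideanSpace.proj j : EuclideanSpace ℂ (Fin r) →L[ℂ] ℂ).smulRight
    ((EuclideanSpace.equiv (Fin r) ℂ).symm (frameCoeff t (fun y => s y j) y))

variable {X : Type*} [NormedAddCommGroup X] [NormedSpace ℝ X] {H : Type*} [TopologicalSpace H]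
  {I : ModelWithCorners ℝ X H} [TopologicalSpace Y] [ChartedSpace H Y]
  {FD : Type*} [NormedAddCommGroup FD] [NormedSpace ℂ FD]
  [TopologicalSpace (TotalSpace FD D)] [FiberBundle FD D]
  {s : ∀ y, Fin r → KernelFiber S P y} {y : Y}

theorem IsKernelFrameAt.linearCombination_frameCoeff (hs : IsKernelFrameAt I FD S P s y)
    (t : ∀ y, KernelFiber S P y) :
    Fintype.linearCombination ℂ (s y) (frameCoeff s t y) = t y :=
  Function.rightInverse_invFun hs.bijective.2 (t y)

theorem IsKernelFrameAt.frameMap_frameCoeff (hs : IsKernelFrameAt I FD S P s y)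
    (t : ∀ y, KernelFiber S P y) :
    frameMap s y ((EuclideanSpace.equiv (Fin r) ℂ).symm (frameCoeff s t y)) = t y :=
  Function.rightInverse_invFun hs.bijective.2 (t y)

theorem IsKernelFrameAt.frameMap_frameChange {t : ∀ y, Fin r → KernelFiber S P y}
    (ht : IsKernelFrameAt I FD S P t y) (v : EuclideanSpace ℂ (Fin r)) :
    frameMap t y (frameChange s t y v) = frameMap s y v := by
  have hchange : frameChange s t y v =
      ∑ j, v j • (EuclideanSpace.equiv (Fin r) ℂ).symm (frameCoeff t (fun y => s y j) y) := by
    simp only [frameChange, sum_apply]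
    rfl
  simp only [hchange, map_sum, map_smul, ht.frameMap_frameCoeff]
  exact (Fintype.linearCombination_apply ℂ (s y) _).symm

theorem IsKernelFrameAt.finrank_eq (hs : IsKernelFrameAt I FD S P s y) :
    Module.finrank ℂ (KernelFiber S P y) = r := by
  rw [← (LinearEquiv.ofBijective _ hs.bijective).finrank_eq, Module.finrank_fin_fun]

theorem exists_isKernelFrameAt_of_preconnected [PreconnectedSpace Y] [Nonempty Y]
    (h : ∀ y₀, ∃ (r : ℕ) (s : ∀ y, Fin r → KernelFiber S P y),
      ∀ᶠ y in 𝓝 y₀, IsKernelFrameAt I FD S P s y) :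
    ∃ r : ℕ, ∀ y₀, ∃ s : ∀ y, Fin r → KernelFiber S P y,
      ∀ᶠ y in 𝓝 y₀, IsKernelFrameAt I FD S P s y := by
  have hconst : IsLocallyConstant fun y => Module.finrank ℂ (KernelFiber S P y) := by
    refine (IsLocallyConstant.iff_eventually_eq _).2 fun y₀ => ?_
    obtain ⟨r, s, hs⟩ := h y₀
    filter_upwards [hs] with y hy
    rw [hy.finrank_eq, hs.self_of_nhds.finrank_eq]
  obtain ⟨y₁⟩ := ‹Nonempty Y›
  refine ⟨Module.finrank ℂ (KernelFiber S P y₁), fun y₀ => ?_⟩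
  obtain ⟨r, s, hs⟩ := h y₀
  obtain rfl : r = Module.finrank ℂ (KernelFiber S P y₁) :=
    hs.self_of_nhds.finrank_eq.symm.trans (hconst.apply_eq_of_preconnectedSpace _ _)
  exact ⟨s, hs⟩

variable [VectorBundle ℂ FD D] [ContMDiffVectorBundle ∞ FD D I]

theorem IsKernelFrameAt.contMDiffAt_sum (hs : IsKernelFrameAt I FD S P s y)
    {σ : ℂ} (hσ : σ ∉ singPts S (P y)) {c : Y → Fin r → ℂ}
    (hc : ContMDiffAt I 𝓘(ℝ, Fin r → ℂ) ∞ c y) :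
    ContMDiffAt (I.prod 𝓘(ℝ, ℂ)) (I.prod 𝓘(ℝ, FD)) ∞
      (fun p : Y × ℂ => TotalSpace.mk' FD p.1 (∑ j, c p.1 j • (s p.1 j).toFun p.2)) (y, σ) := by
  set e := trivializationAt FD D y
  have hy : y ∈ e.baseSet := mem_baseSet_trivializationAt FD D y
  refine (e.contMDiffAt_iff (x₀ := (y, σ)) (e.mem_source.2 hy)).2 ⟨contMDiffAt_fst, ?_⟩
  have hterm : ∀ j, ContMDiffAt (I.prod 𝓘(ℝ, ℂ)) 𝓘(ℝ, FD) ∞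
      (fun p : Y × ℂ => c p.1 j • (e ⟨p.1, (s p.1 j).toFun p.2⟩).2) (y, σ) := fun j => by
    refine contMDiffAt_complex_smul ?_
      ((e.contMDiffAt_iff (x₀ := (y, σ)) (e.mem_source.2 hy)).1 (hs.smooth σ hσ j)).2
    exact ContMDiffAt.comp (x := (y, σ)) (f := Prod.fst) (g := fun y => c y j)
      (contMDiffAt_pi_space.1 hc j) contMDiffAt_fst
  refine (contMDiffAt_finsetSum (t := Finset.univ) fun j _ => hterm j).congr_of_eventuallyEq ?_
  filter_upwards [continuous_fst.continuousAt.eventually (e.open_baseSet.mem_nhds hy)] with p hp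
  have hlin : ∀ v, (e ⟨p.1, v⟩).2 = e.linearEquivAt ℂ p.1 hp v := fun v => rfl
  simp only [hlin, map_sum, map_smul]

theorem IsKernelFrameAt.contMDiffAt_coeff_iff (hs : IsKernelFrameAt I FD S P s y)
    {t : ∀ y, KernelFiber S P y} {c : Y → Fin r → ℂ}
    (hc : ∀ᶠ y' in 𝓝 y, Fintype.linearCombination ℂ (s y') (c y') = t y') :
    ContMDiffAt I 𝓘(ℝ, Fin r → ℂ) ∞ c y ↔ ∀ σ, σ ∉ singPts S (P y) →
      ContMDiffAt (I.prod 𝓘(ℝ, ℂ)) (I.prod 𝓘(ℝ, FD)) ∞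
        (fun p : Y × ℂ => TotalSpace.mk' FD p.1 ((t p.1).toFun p.2)) (y, σ) := by
  have hsum : ∀ᶠ y' in 𝓝 y, ∀ σ, TotalSpace.mk' FD y' ((t y').toFun σ) =
      TotalSpace.mk' FD y' (∑ j, c y' j • (s y' j).toFun σ) := hc.mono fun y' hy' σ => by
    rw [← hy', KernelFiber.toFun_linearCombination]
  refine ⟨fun h σ hσ => (hs.contMDiffAt_sum hσ h).congr_of_eventuallyEq ?_,
    fun h => hs.coeff_smooth c fun σ hσ => ?_⟩
  · filter_upwards [continuous_fst.continuousAt.eventually hsum] with p hp using hp p.2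
  · have hslice : ContMDiffAt I (I.prod 𝓘(ℝ, FD)) ∞
        (fun y => TotalSpace.mk' FD y ((t y).toFun σ)) y :=
      ContMDiffAt.comp (f := fun y => (y, σ)) (x := y) (h σ hσ)
        (contMDiffAt_id.prodMk contMDiffAt_const)
    exact hslice.congr_of_eventuallyEq (hsum.mono fun y' hy' => (hy' σ).symm)

theorem IsKernelFrameAt.contMDiffAt_frameChange {t : ∀ y, Fin r → KernelFiber S P y}
    (hs : IsKernelFrameAt I FD S P s y) (ht : ∀ᶠ y' in 𝓝 y, IsKernelFrameAt I FD S P t y') :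
    ContMDiffAt I 𝓘(ℝ, EuclideanSpace ℂ (Fin r) →L[ℂ] EuclideanSpace ℂ (Fin r)) ∞
      (frameChange s t) y := by
  refine contMDiffAt_finsetSum fun j _ => ?_
  have hcoeff := (ht.self_of_nhds.contMDiffAt_coeff_iff (ht.mono fun y' hy' =>
    hy'.linearCombination_frameCoeff fun y => s y j)).2 fun σ hσ => hs.smooth σ hσ j
  exact contMDiffAt_const_clm_apply (ContinuousLinearMap.smulRightL ℂ _ _
    (EuclideanSpace.proj j : EuclideanSpace ℂ (Fin r) →L[ℂ] ℂ))
    (contMDiffAt_const_clm_apply ((EuclideanSpace.equiv (Fin r) ℂ).symm :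
      (Fin r → ℂ) →L[ℂ] EuclideanSpace ℂ (Fin r)) hcoeff)

/-- The atlas given by frames `s i` of the kernel bundle near the points `i`. -/
def kernelAtlas (s : ∀ _ y : Y, Fin r → KernelFiber S P y)
    (hs : ∀ i, ∀ᶠ y in 𝓝 i, IsKernelFrameAt I FD S P (s i) y) :
    SmoothFrameAtlas I (EuclideanSpace ℂ (Fin r)) (KernelFiber S P) where
  U i := interior {y | IsKernelFrameAt I FD S P (s i) y}
  isOpen_U _ := isOpen_interior
  mem_U i := mem_interior_iff_mem_nhds.2 (hs i)
  frame i := frameMap (s i)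
  bijective_frame _ _ hy :=
    (interior_subset hy).bijective.comp (EuclideanSpace.equiv (Fin r) ℂ).bijective
  coordChange i k := frameChange (s i) (s k)
  contMDiffOn_coordChange _ _ _ hy := ((interior_subset hy.1).contMDiffAt_frameChange
    (mem_interior_iff_mem_nhds.1 hy.2)).contMDiffWithinAt
  frame_coordChange _ _ _ hy := (interior_subset hy.2).frameMap_frameChange

theorem exists_kernelBundle
    (h : ∀ y₀, ∃ s : ∀ y, Fin r → KernelFiber S P y, ∀ᶠ y in 𝓝 y₀, IsKernelFrameAt I FD S P s y) :
    ∃ (_ : TopologicalSpace (TotalSpace (EuclideanSpace ℂ (Fin r)) (KernelFiber S P)))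
      (_ : ∀ y, TopologicalSpace (KernelFiber S P y))
      (_ : FiberBundle (EuclideanSpace ℂ (Fin r)) (KernelFiber S P))
      (_ : VectorBundle ℂ (EuclideanSpace ℂ (Fin r)) (KernelFiber S P)),
      ContMDiffVectorBundle ∞ (EuclideanSpace ℂ (Fin r)) (KernelFiber S P) I ∧
      ∀ t : ∀ y, KernelFiber S P y,
        ContMDiff I (I.prod 𝓘(ℝ, EuclideanSpace ℂ (Fin r))) ∞
          (fun y => TotalSpace.mk' (EuclideanSpace ℂ (Fin r)) y (t y)) ↔
        ∀ y, ∀ σ, σ ∉ singPts S (P y) →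
          ContMDiffAt (I.prod 𝓘(ℝ, ℂ)) (I.prod 𝓘(ℝ, FD)) ∞
            (fun p : Y × ℂ => TotalSpace.mk' FD p.1 ((t p.1).toFun p.2)) (y, σ) := by
  choose s hs using h
  let L : EuclideanSpace ℂ (Fin r) ≃L[ℂ] (Fin r → ℂ) := EuclideanSpace.equiv (Fin r) ℂ
  obtain ⟨i₁, i₂, i₃, i₄, hbundle, hsec⟩ := (kernelAtlas s hs).exists_contMDiffVectorBundle
  refine ⟨i₁, i₂, i₃, i₄, hbundle, fun t => forall_congr' fun y₀ => ?_⟩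
  refine (hsec t y₀ (fun y => L.symm (frameCoeff (s y₀) t y)) fun y hy =>
    (interior_subset hy).frameMap_frameCoeff t).trans ?_
  rw [← (hs y₀).self_of_nhds.contMDiffAt_coeff_iff
    ((hs y₀).mono fun y hy => hy.linearCombination_frameCoeff t)]
  refine ⟨fun h => ?_, fun h =>
    contMDiffAt_const_clm_apply (L.symm : (Fin r → ℂ) →L[ℂ] EuclideanSpace ℂ (Fin r)) h⟩
  refine (contMDiffAt_const_clm_apply (L : EuclideanSpace ℂ (Fin r) →L[ℂ] (Fin r → ℂ))
    h).congr_of_eventuallyEq (.of_forall fun y => (L.apply_symm_apply _).symm)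

theorem completeSpace_fiber (FD : Type*) [NormedAddCommGroup FD] [NormedSpace ℂ FD]
    [CompleteSpace FD] [TopologicalSpace (TotalSpace FD D)] [FiberBundle FD D]
    [VectorBundle ℂ FD D] (y : Y) : CompleteSpace (D y) := by
  let T : D y ≃L[ℂ] FD :=
    (trivializationAt FD D y).continuousLinearEquivAt ℂ y (mem_baseSet_trivializationAt FD D y)
  exact (completeSpace_congr (e := T.toEquiv) T.isUniformEmbedding).2 inferInstance

theorem isSmoothOffSing_iff {n : ℕ} [ChartedSpace (EuclideanSpace ℝ (Fin n)) Y]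
    [ContMDiffVectorBundle ∞ FD D (𝓡 n)]
    (hS : IsOpen S) (hP : ∀ y, IsFredholmOn S (P y))
    [∀ y, CompleteSpace (D y)] [∀ y, CompleteSpace (H₂ y)]
    (hclosed : IsClosed (singGraph S P)) (s : ∀ y, KernelFiber S P y) :
    IsSmoothOffSing n FD S P s ↔ ∀ y, ∀ σ, σ ∉ singPts S (P y) →
      ContMDiffAt ((𝓡 n).prod 𝓘(ℝ, ℂ)) ((𝓡 n).prod 𝓘(ℝ, FD)) ∞
        (fun p : Y × ℂ => TotalSpace.mk' FD p.1 ((s p.1).toFun p.2)) (y, σ) := by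
  have hdiff : ∀ y, DifferentiableOn ℂ (s y).toFun (singPts S (P y))ᶜ := fun y σ hσ =>
    (analyticAt_of_mem_polarSums ((hP y).mem_polarSums hS (s y).2)
      hσ).differentiableAt.differentiableWithinAt
  refine ⟨fun h y σ hσ => ?_, fun h => ⟨fun e _ p hp => ?_, hdiff⟩⟩
  · set e := trivializationAt FD D y
    have hy : y ∈ e.baseSet := mem_baseSet_trivializationAt FD D y
    have hopen : IsOpen ((e.baseSet ×ˢ univ) \ singGraph S P) :=
      (e.open_baseSet.prod isOpen_univ).sdiff hclosed
    exact (e.contMDiffAt_iff (x₀ := (y, σ)) (e.mem_source.2 hy)).2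
      ⟨contMDiffAt_fst, (h.1 e).contMDiffAt (hopen.mem_nhds ⟨⟨hy, mem_univ _⟩, hσ⟩)⟩
  · exact ((e.contMDiffAt_iff (e.mem_source.2 hp.1.1)).1
      (h p.1 p.2 hp.2)).2.contMDiffWithinAt

theorem IsHolomorphicFredholmFamily.isFredholmOn {n : ℕ} [ChartedSpace (EuclideanSpace ℝ (Fin n)) Y]
    {H₁ : Y → Type*} [∀ y, NormedAddCommGroup (H₁ y)] [∀ y, NormedSpace ℂ (H₁ y)]
    {F₂ : Type*} [NormedAddCommGroup F₂] [NormedSpace ℂ F₂]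
    [TopologicalSpace (TotalSpace F₂ H₂)] [FiberBundle F₂ H₂] [VectorBundle ℂ F₂ H₂]
    {i : ∀ y, D y →L[ℂ] H₁ y} (hP : IsHolomorphicFredholmFamily n FD F₂ i S P)
    (hfin : ∀ y, (singPts S (P y)).Finite) (y : Y) : IsFredholmOn S (P y) where
  differentiableOn := hP.holomorphic y
  correction σ hσ := .of_isFredholm (hP.fredholm y σ hσ) (hP.index_eq_zero y σ hσ)
  finite := hfin y

end Sections

end

end KernelBundle

theorem theorem3p1_general
    {n : ℕ} {Y : Type*} [TopologicalSpace Y] [ConnectedSpace Y]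
    [ChartedSpace (EuclideanSpace ℝ (Fin n)) Y] [IsManifold (𝓡 n) ∞ Y]
    {FD F₂ : Type*}
    [NormedAddCommGroup FD] [NormedSpace ℂ FD] [CompleteSpace FD]
    [NormedAddCommGroup F₂] [NormedSpace ℂ F₂] [CompleteSpace F₂]
    {D H₂ : Y → Type*}
    [∀ y, NormedAddCommGroup (D y)] [∀ y, NormedSpace ℂ (D y)]
    [TopologicalSpace (TotalSpace FD D)] [FiberBundle FD D] [VectorBundle ℂ FD D]
    [ContMDiffVectorBundle ∞ FD D (𝓡 n)]
    [∀ y, NormedAddCommGroup (H₂ y)] [∀ y, NormedSpace ℂ (H₂ y)]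
    [TopologicalSpace (TotalSpace F₂ H₂)] [FiberBundle F₂ H₂] [VectorBundle ℂ F₂ H₂]
    {S : Set ℂ} (hS : IsOpen S) {P : ∀ y, ℂ → D y →L[ℂ] H₂ y}
    (hsmooth : ∀ (e : Trivialization FD (π FD D)) [MemTrivializationAtlas e]
      (e₂ : Trivialization F₂ (π F₂ H₂)) [MemTrivializationAtlas e₂],
      ContMDiffOn ((𝓡 n).prod 𝓘(ℝ, ℂ)) 𝓘(ℝ, FD →L[ℂ] F₂) ∞
        (fun p : Y × ℂ => localFamily e e₂ P p.1 p.2) ((e.baseSet ∩ e₂.baseSet) ×ˢ S))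
    (hP : ∀ y, IsFredholmOn S (P y))
    (hclosed : IsClosed (singGraph S P))
    (hbdd : ∀ y₀ : Y, ∃ U ∈ 𝓝 y₀, Bornology.IsBounded (⋃ y ∈ U, singPts S (P y))) :
    ∃ (r : ℕ)
      (_ : TopologicalSpace (TotalSpace (EuclideanSpace ℂ (Fin r)) (KernelFiber S P)))
      (_ : ∀ y, TopologicalSpace (KernelFiber S P y))
      (_ : FiberBundle (EuclideanSpace ℂ (Fin r)) (KernelFiber S P))
      (_ : VectorBundle ℂ (EuclideanSpace ℂ (Fin r)) (KernelFiber S P)),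
      ContMDiffVectorBundle ∞ (EuclideanSpace ℂ (Fin r)) (KernelFiber S P) (𝓡 n) ∧
      ∀ s : ∀ y, KernelFiber S P y,
        ContMDiff (𝓡 n) ((𝓡 n).prod 𝓘(ℝ, EuclideanSpace ℂ (Fin r))) ∞
          (fun y => TotalSpace.mk' (EuclideanSpace ℂ (Fin r)) y (s y)) ↔
        IsSmoothOffSing n FD S P s := by
  have hD : ∀ y, CompleteSpace (D y) := completeSpace_fiber FD
  have hH₂ : ∀ y, CompleteSpace (H₂ y) := completeSpace_fiber F₂
  have hframe : ∀ y₀, ∃ (r : ℕ) (s : ∀ y, Fin r → KernelFiber S P y),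
      ∀ᶠ y in 𝓝 y₀, IsKernelFrameAt (𝓡 n) FD S P s y := fun y₀ =>
    exists_isKernelFrameAt (trivializationAt FD D y₀) (trivializationAt F₂ H₂ y₀) hS (hsmooth _ _)
      hP (fun y => upperHemicontinuousAt_singPts hclosed (hbdd y))
      ⟨mem_baseSet_trivializationAt FD D y₀, mem_baseSet_trivializationAt F₂ H₂ y₀⟩
  obtain ⟨r, hr⟩ := exists_isKernelFrameAt_of_preconnected hframe
  obtain ⟨i₁, i₂, i₃, i₄, hbundle, hsec⟩ := exists_kernelBundle hr
  exact ⟨r, i₁, i₂, i₃, i₄, hbundle, fun s =>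
    (hsec s).trans (isSmoothOffSing_iff hS hP hclosed s).symm⟩

theorem theorem3p1
    -- the base: a connected smooth manifold
    {n : ℕ} {Y : Type*} [TopologicalSpace Y] [ConnectedSpace Y]
    [ChartedSpace (EuclideanSpace ℝ (Fin n)) Y] [IsManifold (𝓡 n) ∞ Y]
    -- the smooth Hilbert space bundles, with their model spaces
    {FD F₁ F₂ : Type*}
    [NormedAddCommGroup FD] [InnerProductSpace ℂ FD] [CompleteSpace FD]
    [NormedAddCommGroup F₁] [InnerProductSpace ℂ F₁] [CompleteSpace F₁]
    [NormedAddCommGroup F₂] [InnerProductSpace ℂ F₂] [CompleteSpace F₂]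
    {D H₁ H₂ : Y → Type*}
    [∀ y, NormedAddCommGroup (D y)] [∀ y, InnerProductSpace ℂ (D y)]
    [TopologicalSpace (TotalSpace FD D)] [FiberBundle FD D] [VectorBundle ℂ FD D]
    [ContMDiffVectorBundle ∞ FD D (𝓡 n)]
    [∀ y, NormedAddCommGroup (H₁ y)] [∀ y, InnerProductSpace ℂ (H₁ y)]
    [TopologicalSpace (TotalSpace F₁ H₁)] [FiberBundle F₁ H₁] [VectorBundle ℂ F₁ H₁]
    [ContMDiffVectorBundle ∞ F₁ H₁ (𝓡 n)] (_hH₁ : HasUnitaryTrivializations F₁ H₁)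
    [∀ y, NormedAddCommGroup (H₂ y)] [∀ y, InnerProductSpace ℂ (H₂ y)]
    [TopologicalSpace (TotalSpace F₂ H₂)] [FiberBundle F₂ H₂] [VectorBundle ℂ F₂ H₂]
    [ContMDiffVectorBundle ∞ F₂ H₂ (𝓡 n)] (_hH₂ : HasUnitaryTrivializations F₂ H₂)
    -- the embedding of `D` in `H₁`
    (j : FD →L[ℂ] F₁) (i : ∀ y, D y →L[ℂ] H₁ y) (_hi : IsDenseSubbundle n j i)
    -- the family of operators
    (S : Set ℂ) (_hSo : IsOpen S) (_hSc : IsConnected S)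
    (P : ∀ y, ℂ → D y →L[ℂ] H₂ y)
    (_hP : IsHolomorphicFredholmFamily n FD F₂ i S P)
    -- finiteness, closedness and local boundedness of the singular set
    (_hfin : ∀ y, (singPts S (P y)).Finite)
    (_hclosed : IsClosed (singGraph S P))
    (_hbdd : ∀ y₀ : Y, ∃ U ∈ 𝓝 y₀, Bornology.IsBounded (⋃ y ∈ U, singPts S (P y))) :
    ∃ (r : ℕ)
      (_ : TopologicalSpace (TotalSpace (EuclideanSpace ℂ (Fin r)) (KernelFiber S P)))
      (_ : ∀ y, TopologicalSpace (KernelFiber S P y))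
      (_ : FiberBundle (EuclideanSpace ℂ (Fin r)) (KernelFiber S P))
      (_ : VectorBundle ℂ (EuclideanSpace ℂ (Fin r)) (KernelFiber S P)),
      ContMDiffVectorBundle ∞ (EuclideanSpace ℂ (Fin r)) (KernelFiber S P) (𝓡 n) ∧
      ∀ s : ∀ y, KernelFiber S P y,
        ContMDiff (𝓡 n) ((𝓡 n).prod 𝓘(ℝ, EuclideanSpace ℂ (Fin r))) ∞
          (fun y => TotalSpace.mk' (EuclideanSpace ℂ (Fin r)) y (s y)) ↔
        IsSmoothOffSing n FD S P s :=
  theorem3p1_general _hSo _hP.smooth (_hP.isFredholmOn _hfin) _hclosed _hbdd
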